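/- Consider the space of complex-valued functions on $GL_3(\mathbb C)$ with the action $(Xf)(g)=f(gX)$ of $GL_3(\mathbb C)$ and the corresponding infinitesimal action of $\mathfrak{gl}_3$. For a matrix $a\in GL_3(\mathbb C)$ let $a_i^j$ be its entry in row $j$ and column $i$, and put $a_i=a_i^1$, $a_{i,j}=a_i^1a_j^2-a_j^1a_i^2$. For integers $m_1\ge m_2\ge 0$ the function $\frac{a_1^{m_1-m_2}}{(m_1-m_2)!}\frac{a_{1,2}^{m_2}}{m_2!}$ is a highest vector of weight $[m_1,m_2,0]$ and generates an irreducible representation $V_{[m_1,m_2,0]}$. Given also integers $\bar m_1\ge\bar m_2\ge0$, realize $V_{[m_1,m_2,0]}\otimes V_{[\bar m_1,\bar m_2,0]}$ as the span of the products $u(a)v(b)$, $u\in V_{[m_1,m_2,0]}$, $v\in V_{[\bar m_1,\bar m_2,0]}$, in the functions of $(a,b)\in GL_3(\mathbb C)\times GL_3(\mathbb C)$, with the diagonal action $(XF)(a,b)=F(aX,bX)$. Its space of $\mathfrak{gl}_3$-highest vectors is the subspace annihilated by $E_{i,j}$ for all $i<j$. Put $$(ab)_{1,2}=a_1b_2-a_2b_1,\qquad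 (aabb)_{1,2,1,3}=a_{1,2}b_{1,3}-a_{1,3}b_{1,2},$$ $$(aab)=\det\begin{pmatrix}a_1^1&a_2^1&a_3^1\\a_1^2&a_2^2&a_3^2\\b_1^1&b_2^1&b_3^1\end{pmatrix},\qquad (abb)=\det\begin{pmatrix}a_1^1&a_2^1&a_3^1\\b_1^1&b_2^1&b_3^1\\b_1^2&b_2^2&b_3^2\end{pmatrix},$$ and $$f(\omega,\varphi,\psi,\theta)=a_1^{\alpha}b_1^{\beta}a_{1,2}^{\gamma}b_{1,2}^{\delta}(ab)_{1,2}^{\omega}(abb)^{\varphi}(aab)^{\psi}(aabb)_{1,2,1,3}^{\theta},$$ where $\alpha,\beta,\gamma,\delta$ are determined by $$\alpha+\omega+\varphi=m_1-m_2,\quad \gamma+\theta+\psi=m_2,\quad \beta+\omega+\psi=\bar m_1-\bar m_2,\quad \delta+\varphi+\theta=\bar m_2.$$ **Proposition.** The space of $\mathfrak{gl}_3$-highest vectors in $V_{[m_1,m_2,0]}\otimes V_{[\bar m_1,\bar m_2,0]}$ has a basis consisting of the vectors $f(0,\varphi,\psi,\theta)$ and the vectors $f(\omega,\varphi,\psi,0)$,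 for all integers $\omega,\varphi,\psi,\theta\ge0$ for which $\alpha,\beta,\gamma,\delta\ge0$ (the vectors $f(0,\varphi,\psi,0)$, which are of both types, are taken once). All these vectors are weight vectors, that is, nonzero common eigenvectors of $E_{1,1},E_{2,2},E_{3,3}$. -/

import Mathlib

/-- The group `GL₃(ℂ)`. -/
abbrev GL3 : Type := Matrix.GeneralLinearGroup (Fin 3) ℂ

/-- The matrix exponential, as an element of the group `GL₃(ℂ)`. -/
noncomputable def expGL (X : Matrix (Fin 3) (Fin 3) ℂ) : GL3 :=
  (Matrix.isUnit_exp X).unit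

/-- The function `g ↦ a_i`: the entry of `g` in the first row and in the column `i`. -/
def minor1 (i : Fin 3) (g : GL3) : ℂ :=
  (g : Matrix (Fin 3) (Fin 3) ℂ) 0 i

/-- The function `g ↦ a_{i,j}`: the determinant of the submatrix of `g` formed by the first two
rows and the columns `i, j`. -/
def minor2 (i j : Fin 3) (g : GL3) : ℂ :=
  ((g : Matrix (Fin 3) (Fin 3) ℂ).submatrix ![0, 1] ![i, j]).det

/-- The subrepresentation generated by a function `v` on `GL₃(ℂ)`, where `GL₃(ℂ)` acts on
functions by `(X f)(g) = f(g X)`: the linear span of all translates of `v`. -/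
def cyclicRep (v : GL3 → ℂ) : Submodule ℂ (GL3 → ℂ) :=
  Submodule.span ℂ (Set.range fun X : GL3 => fun g : GL3 => v (g * X))

/-- The function `a₁^{m₁-m₂} / (m₁-m₂)! * a_{1,2}^{m₂} / m₂!` (used for `m₂ ≤ m₁` only), the
highest vector of weight `[m₁, m₂, 0]`. -/
noncomputable def highestFun (m₁ m₂ : ℕ) (g : GL3) : ℂ :=
  minor1 0 g ^ (m₁ - m₂) / ((m₁ - m₂).factorial : ℂ) *
    (minor2 0 1 g ^ m₂ / (m₂.factorial : ℂ))

/-- The irreducible representation with the highest weight `[m₁, m₂, 0]`, realized in functions on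
`GL₃(ℂ)`. -/
noncomputable def irrep (m₁ m₂ : ℕ) : Submodule ℂ (GL3 → ℂ) :=
  cyclicRep (highestFun m₁ m₂)

/-- The tensor product of two spaces of functions on `GL₃(ℂ)`, realized in functions on
`GL₃(ℂ) × GL₃(ℂ)`: the linear span of the products `u(a) v(b)`. -/
def tensorFun (U V : Submodule ℂ (GL3 → ℂ)) : Submodule ℂ (GL3 × GL3 → ℂ) :=
  Submodule.span ℂ {F | ∃ u ∈ U, ∃ v ∈ V, F = fun p => u p.1 * v p.2}

/-- `F'` is the image of `F` under the element `X` of `𝔤𝔩₃`, for the infinitesimal form of the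
diagonal action `(X F)(a, b) = F(a X, b X)` of `GL₃(ℂ)`. -/
def IsLieImage (X : Matrix (Fin 3) (Fin 3) ℂ) (F F' : GL3 × GL3 → ℂ) : Prop :=
  ∀ a b : GL3,
    HasDerivAt (fun t : ℂ => F (a * expGL (t • X), b * expGL (t • X))) (F' (a, b)) 0

/-- The matrix unit `E_{i,j}` of `𝔤𝔩₃`. -/
def matE (i j : Fin 3) : Matrix (Fin 3) (Fin 3) ℂ := Matrix.single i j 1

/-- The space of `𝔤𝔩₃`-highest vectors in a space `T` of functions on `GL₃(ℂ) × GL₃(ℂ)`: the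
elements of `T` annihilated by `E_{i,j}` for all `i < j`. -/
def highestVectors (T : Submodule ℂ (GL3 × GL3 → ℂ)) : Submodule ℂ (GL3 × GL3 → ℂ) where
  carrier := {F | F ∈ T ∧ ∀ i j : Fin 3, i < j → IsLieImage (matE i j) F 0}
  zero_mem' := ⟨T.zero_mem, fun _ _ _ _ _ => hasDerivAt_const _ _⟩
  add_mem' := fun hF hG => ⟨T.add_mem hF.1 hG.1, fun i j hij a b => by
    simpa [Pi.add_def] using (hF.2 i j hij a b).add (hG.2 i j hij a b)⟩
  smul_mem' := fun c _ hF => ⟨T.smul_mem c hF.1, fun i j hij a b => by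
    simpa using (hF.2 i j hij a b).const_mul c⟩

/-- `F` is a weight vector: an eigenvector of `E_{1,1}`, `E_{2,2}`, `E_{3,3}`. -/
def IsWeightVector (F : GL3 × GL3 → ℂ) : Prop :=
  F ≠ 0 ∧ ∃ μ : Fin 3 → ℂ, ∀ i : Fin 3, IsLieImage (matE i i) F (μ i • F)

/-- `(ab)_{1,2}`. -/
def ab12 (a b : GL3) : ℂ :=
  !![a 0 0, a 0 1; b 0 0, b 0 1].det

/-- `(aab)`: the determinant with rows `a¹, a², b¹`. -/
def aab (a b : GL3) : ℂ :=
  !![a 0 0, a 0 1, a 0 2; a 1 0, a 1 1, a 1 2; b 0 0, b 0 1, b 0 2].det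

/-- `(abb)`: the determinant with rows `a¹, b¹, b²`. -/
def abb (a b : GL3) : ℂ :=
  !![a 0 0, a 0 1, a 0 2; b 0 0, b 0 1, b 0 2; b 1 0, b 1 1, b 1 2].det

/-- `(aabb)_{1,2,1,3} = a_{1,2} b_{1,3} - a_{1,3} b_{1,2}`. -/
def aabb1213 (a b : GL3) : ℂ :=
  minor2 0 1 a * minor2 0 2 b - minor2 0 2 a * minor2 0 1 b

/-- Eight nonnegative exponents. -/
structure Exponents where
  (α β γ δ ω φ ψ θ : ℕ)

/-- The four equations on the exponents for the weights `[m₁, m₂, 0]` and `[n₁, n₂, 0]` (where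
`m₂ ≤ m₁` and `n₂ ≤ n₁`). They determine `α, β, γ, δ` by `ω, φ, ψ, θ`. -/
def Exponents.Admissible (m₁ m₂ n₁ n₂ : ℕ) (e : Exponents) : Prop :=
  e.α + e.ω + e.φ = m₁ - m₂ ∧ e.γ + e.θ + e.ψ = m₂ ∧
    e.β + e.ω + e.ψ = n₁ - n₂ ∧ e.δ + e.φ + e.θ = n₂

/-- The function `f(ω, φ, ψ, θ)` on `GL₃(ℂ) × GL₃(ℂ)`. -/
def fVec (e : Exponents) : GL3 × GL3 → ℂ := fun p =>
  minor1 0 p.1 ^ e.α * minor1 0 p.2 ^ e.β * minor2 0 1 p.1 ^ e.γ * minor2 0 1 p.2 ^ e.δ *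
    ab12 p.1 p.2 ^ e.ω * abb p.1 p.2 ^ e.φ * aab p.1 p.2 ^ e.ψ * aabb1213 p.1 p.2 ^ e.θ

/-! Write `a_i` for the first-row entries of `a` and `A_i` for its signed complementary minors
(`minorDual`). They satisfy `∑ a_i A_i = 0`.

The first ingredient is `irrep_eq_polyRep`: the translates of the highest vector span all
polynomials of bidegree `(p, q) = (m₁ - m₂, m₂)` in the `a_i` and the `A_i`. If a linear functional
`l` kills the translates, then `l ((∑ a_i x_i)^p (∑ A_i z_i)^q)`, a polynomial in `x, z`, vanishes
on the quadric `∑ x_i z_i = 0`, so this form divides it. The relation `∑ a_i A_i = 0` makes it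
harmonic for `∑ ∂²/∂x_i∂z_i`. A harmonic multiple of the form is zero, so `l` kills the whole of
`polyRep p q`.

The second ingredient is that a highest vector `F` is invariant under the upper unitriangular group,
and that a generic `a` can be moved by this group to a point where `F(·, b)` is a scalar multiple of
its value at `1`. Hence `F` is determined by `F(1, b)` (`eq_zero_of_highest_of_one`). The vectors
`f` restrict to monomials in the `b_i` and `B_i` up to sign, and those with `ωθ = 0` span modulo `∑
b_i B_i = 0`. Invariance bounds two degrees of `F(1, b)` on unitriangular `b`. Comparing leading
coefficients (`coeff_eq_zero_of_degree_lt`) yields linear independence and the inequalities `ω + φ ≤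
m₁ - m₂`, `θ + ψ ≤ m₂`, which are exactly `α, γ ≥ 0`. -/

open MvPolynomial in
/-- The quadratic form `∑ i, xᵢ zᵢ`. -/
noncomputable def incidenceForm : MvPolynomial (Fin 3 ⊕ Fin 3) ℂ :=
  ∑ i : Fin 3, X (Sum.inl i) * X (Sum.inr i)

open MvPolynomial in
/-- The differential operator `∑ i, ∂/∂xᵢ ∂/∂zᵢ`, dual to the incidence form. -/
noncomputable def incidenceLaplacian {R : Type*} [CommRing R]
    (P : MvPolynomial (Fin 3 ⊕ Fin 3) R) : MvPolynomial (Fin 3 ⊕ Fin 3) R :=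
  ∑ i : Fin 3, pderiv (Sum.inl i) (pderiv (Sum.inr i) P)

/-! ### Harmonic polynomials and the incidence quadric. -/

namespace MvPolynomial

theorem incidenceForm_isHomogeneous : incidenceForm.IsHomogeneous 2 :=
  IsHomogeneous.sum _ _ _ fun i _ => (isHomogeneous_X ℂ (Sum.inl i)).mul (isHomogeneous_X ℂ (Sum.inr i))

theorem incidenceForm_irreducible : Irreducible incidenceForm := by
  have h := irreducible_sumSMulXSMulY (R := ℂ) (n := Fin 3) (Finsupp.equivFunOnFinite.symm 1) (by
      refine ⟨0, ?_, 1, ?_, by decide⟩ <;> simp) (fun r hr => isUnit_of_dvd_one (by simpa using hr 0))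
  convert h using 1
  simp [incidenceForm, sumSMulXSMulY, Finsupp.linearCombination_apply, Finsupp.sum_fintype]

theorem incidenceLaplacian_zero {R : Type*} [CommRing R] :
    incidenceLaplacian (0 : MvPolynomial (Fin 3 ⊕ Fin 3) R) = 0 := by
  simp [incidenceLaplacian]

/-- The commutator of the Laplacian with multiplication by the form is the Euler operator plus 3,
and the Euler operator acts on `R` as `n`. -/
theorem incidenceLaplacian_mul_form {n : ℕ} {R : MvPolynomial (Fin 3 ⊕ Fin 3) ℂ}
    (hR : R.IsHomogeneous n) :
    incidenceLaplacian (incidenceForm * R) =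
      incidenceForm * incidenceLaplacian R + (n + 3 : ℕ) • R := by
  have hE := hR.sum_X_mul_pderiv
  rw [Fintype.sum_sum_type] at hE
  rw [add_smul, ← hE]
  simp [incidenceLaplacian, incidenceForm, Fin.sum_univ_three, pderiv_X, Pi.single_apply]
  ring

theorem IsHomogeneous.incidenceLaplacian {n : ℕ} {R : MvPolynomial (Fin 3 ⊕ Fin 3) ℂ}
    (hR : R.IsHomogeneous n) : (incidenceLaplacian R).IsHomogeneous (n - 2) :=
  IsHomogeneous.sum _ _ _ fun _ _ => hR.pderiv.pderiv

/-- Applying the Laplacian to the equation gives an equation of the same shape for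
`incidenceLaplacian R`, of lower degree and with a larger constant. By induction the Laplacian of
`R` vanishes, and the positive constant `c + 1` then forces `R = 0`. -/
theorem eq_zero_of_form_mul_laplacian_add (n : ℕ) : ∀ (c : ℕ) (R : MvPolynomial (Fin 3 ⊕ Fin 3) ℂ),
    R.IsHomogeneous n → incidenceForm * incidenceLaplacian R + (c + 1) • R = 0 → R = 0 := by
  induction n using Nat.strong_induction_on with
  | _ n ih =>
    intro c R hR h
    have hL : _root_.incidenceLaplacian R = 0 := by
      rcases Nat.lt_or_ge n 1 with hn | hn
      · obtain rfl : n = 0 := by omega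
        rw [← totalDegree_zero_iff_isHomogeneous, totalDegree_eq_zero_iff_eq_C] at hR
        rw [hR]; simp [_root_.incidenceLaplacian]
      · refine ih (n - 2) (by omega) (n - 2 + 3 + c) _ hR.incidenceLaplacian ?_
        have h2 := congrArg _root_.incidenceLaplacian h
        have h3 : _root_.incidenceLaplacian (incidenceForm * _root_.incidenceLaplacian R
            + (c + 1) • R) = _root_.incidenceLaplacian (incidenceForm * _root_.incidenceLaplacian R)
            + (c + 1) • _root_.incidenceLaplacian R := by
          simp only [_root_.incidenceLaplacian, map_add, map_nsmul, Finset.sum_add_distrib,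
            Finset.smul_sum]
        rw [h3, incidenceLaplacian_mul_form hR.incidenceLaplacian, incidenceLaplacian_zero] at h2
        rw [← h2]
        simp only [nsmul_eq_mul]; push_cast; ring
    rw [hL, mul_zero, zero_add] at h
    exact (smul_eq_zero.mp h).resolve_left (by omega)

/-- A homogeneous polynomial that is harmonic for the incidence form and divisible by it is zero. -/
theorem eq_zero_of_form_dvd_of_laplacian_eq_zero {N : ℕ} {P : MvPolynomial (Fin 3 ⊕ Fin 3) ℂ}
    (hP : P.IsHomogeneous N) (hdvd : incidenceForm ∣ P) (hL : incidenceLaplacian P = 0) :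
    P = 0 := by
  obtain ⟨R, rfl⟩ := hdvd
  by_cases h0 : incidenceForm * R = 0
  · exact h0
  have hdeg := hP.totalDegree h0
  have hR0 : R ≠ 0 := right_ne_zero_of_mul h0
  rw [totalDegree_mul_of_isDomain incidenceForm_irreducible.ne_zero hR0,
    incidenceForm_isHomogeneous.totalDegree incidenceForm_irreducible.ne_zero] at hdeg
  -- The cofactor may be taken homogeneous: compare components of degree `N`, which is 2 plus the
  -- degree of `R`.
  have hR : incidenceForm * R = incidenceForm * homogeneousComponent R.totalDegree R := by
    let _ : GradedRing (homogeneousSubmodule (Fin 3 ⊕ Fin 3) ℂ) := gradedAlgebra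
    have h := DirectSum.coe_decompose_mul_add_of_left_mem
      (homogeneousSubmodule (Fin 3 ⊕ Fin 3) ℂ) (i := 2) (j := R.totalDegree) (b := R)
      incidenceForm_isHomogeneous
    have hd : ∀ (φ : MvPolynomial (Fin 3 ⊕ Fin 3) ℂ) (i : ℕ),
        (DirectSum.decompose (homogeneousSubmodule (Fin 3 ⊕ Fin 3) ℂ) φ i :
          MvPolynomial (Fin 3 ⊕ Fin 3) ℂ) = homogeneousComponent i φ :=
      decomposition.decompose'_apply
    rw [hd, hd, hdeg] at h
    rw [← h]
    exact (homogeneousComponent_eq_self hP).symm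
  rw [hR] at hL ⊢
  have hh := homogeneousComponent_isHomogeneous R.totalDegree R
  rw [incidenceLaplacian_mul_form hh] at hL
  rw [eq_zero_of_form_mul_laplacian_add _ (R.totalDegree + 2) _ hh hL, mul_zero]

/-- A polynomial that vanishes at the general points of the incidence quadric is divisible by the
incidence form. -/
theorem incidenceForm_dvd {P : MvPolynomial (Fin 3 ⊕ Fin 3) ℂ}
    (hP : ∀ x z : Fin 3 → ℂ, x 2 ≠ 0 → z 0 ≠ 0 → ∑ i, x i * z i = 0 →
      eval (Sum.elim x z) P = 0) : incidenceForm ∣ P := by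
  have hprime : Prime incidenceForm := incidenceForm_irreducible.prime
  have hX : ∀ s : Fin 3 ⊕ Fin 3, ¬ incidenceForm ∣ X s := fun s hs => by
    have := totalDegree_le_of_dvd_of_isDomain hs (X_ne_zero s)
    rw [incidenceForm_isHomogeneous.totalDegree hprime.ne_zero, totalDegree_X] at this
    omega
  -- The extra factor makes the product vanish on the whole quadric, so the Nullstellensatz for a
  -- prime ideal applies. The form, of degree 2, divides neither variable.
  have key : incidenceForm ∣ P * (X (Sum.inl 2) * X (Sum.inr 0)) := by
    have hI : (Ideal.span {incidenceForm}).IsPrime :=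
      (Ideal.span_singleton_prime hprime.ne_zero).mpr hprime
    rw [← Ideal.mem_span_singleton, ← IsPrime.vanishingIdeal_zeroLocus (K := ℂ)
      (Ideal.span {incidenceForm}), mem_vanishingIdeal_iff]
    intro y hy
    have hy' := hy _ (Ideal.mem_span_singleton_self _)
    by_cases h1 : y (Sum.inl 2) = 0
    · simp [h1]
    by_cases h2 : y (Sum.inr 0) = 0
    · simp [h2]
    have h3 := hP (fun i => y (Sum.inl i)) (fun i => y (Sum.inr i)) h1 h2 (by
      simpa [incidenceForm] using hy')
    have h4 : Sum.elim (fun i => y (Sum.inl i)) (fun i => y (Sum.inr i)) = y := by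
      ext (i | i) <;> rfl
    rw [h4] at h3
    rw [map_mul, aeval_eq_eval, h3, zero_mul]
  rcases hprime.dvd_or_dvd key with h | h
  · exact h
  · rcases hprime.dvd_or_dvd h with h | h
    · exact absurd h (hX _)
    · exact absurd h (hX _)

/-! ### Linear functionals applied to coefficients. -/

/-- The polynomial obtained by applying a linear functional to the coefficients. -/
noncomputable def coeffMap {σ S : Type*} [CommRing S] [Algebra ℂ S] (l : S →ₗ[ℂ] ℂ)
    (P : MvPolynomial σ S) : MvPolynomial σ ℂ :=
  ∑ m ∈ P.support, monomial m (l (coeff m P))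

section coeffMap

variable {σ S : Type*} [CommRing S] [Algebra ℂ S] (l : S →ₗ[ℂ] ℂ)

theorem coeff_coeffMap (P : MvPolynomial σ S) (m : σ →₀ ℕ) :
    coeff m (coeffMap l P) = l (coeff m P) := by
  classical
  simp only [coeffMap, coeff_sum, coeff_monomial, Finset.sum_ite_eq', mem_support_iff]
  split_ifs with h
  · rfl
  · rw [not_not.mp h, map_zero]

theorem coeffMap_add (P Q : MvPolynomial σ S) :
    coeffMap l (P + Q) = coeffMap l P + coeffMap l Q := by
  ext m; simp [coeff_coeffMap]

theorem coeffMap_C_mul (c : ℂ) (P : MvPolynomial σ S) :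
    coeffMap l (C (algebraMap ℂ S c) * P) = C c * coeffMap l P := by
  ext m; simp [coeff_coeffMap, ← Algebra.smul_def]

theorem coeffMap_C (s : S) : coeffMap l (C s : MvPolynomial σ S) = C (l s) := by
  classical
  ext m; simp only [coeff_coeffMap, coeff_C]; split_ifs <;> simp

theorem coeffMap_zero : coeffMap l (0 : MvPolynomial σ S) = 0 := by
  ext m; simp [coeff_coeffMap]

theorem coeffMap_sum {ι : Type*} (s : Finset ι) (P : ι → MvPolynomial σ S) :
    coeffMap l (∑ i ∈ s, P i) = ∑ i ∈ s, coeffMap l (P i) := by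
  ext m; simp [coeff_coeffMap, coeff_sum]

theorem pderiv_coeffMap (i : σ) (P : MvPolynomial σ S) :
    pderiv i (coeffMap l P) = coeffMap l (pderiv i P) := by
  ext m
  have : ∀ n : ℕ, coeff (m + Finsupp.single i 1) P * ((n : S) + 1) =
      ((n : ℂ) + 1) • coeff (m + Finsupp.single i 1) P := fun n => by
    rw [Algebra.smul_def, mul_comm]; simp
  rw [coeff_pderiv, coeff_coeffMap, coeff_coeffMap, coeff_pderiv, this, map_smul, smul_eq_mul,
    mul_comm]

theorem eval_coeffMap (x : σ → ℂ) (P : MvPolynomial σ S) :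
    eval x (coeffMap l P) = l (eval (fun i => algebraMap ℂ S (x i)) P) := by
  rw [coeffMap, map_sum, eval_eq, map_sum]
  refine Finset.sum_congr rfl fun m _ => ?_
  rw [eval_monomial, Finsupp.prod]
  simp only [← map_pow, ← map_prod]
  rw [mul_comm (coeff m P), ← Algebra.smul_def, map_smul, smul_eq_mul, mul_comm]

theorem IsHomogeneous.coeffMap {P : MvPolynomial σ S} {n : ℕ} (hP : P.IsHomogeneous n) :
    (coeffMap l P).IsHomogeneous n := fun m hm => hP fun h => hm (by
  rw [coeff_coeffMap, h, map_zero])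

end coeffMap

end MvPolynomial

/-! ### Row entries, minors and the polynomials in them. -/

/-- The minor of the first two rows complementary to the column `i`, with its sign. -/
def minorDual (i : Fin 3) : GL3 → ℂ := minor2 (i + 1) (i + 2)

theorem minor2_apply (i j : Fin 3) (g : GL3) :
    minor2 i j g = g 0 i * g 1 j - g 0 j * g 1 i := by
  rw [minor2, Matrix.det_fin_two]
  simp

theorem minorDual_zero_apply (g : GL3) : minorDual 0 g = g 0 1 * g 1 2 - g 0 2 * g 1 1 :=
  minor2_apply 1 2 g

theorem minorDual_one_apply (g : GL3) : minorDual 1 g = g 0 2 * g 1 0 - g 0 0 * g 1 2 :=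
  minor2_apply 2 0 g

theorem minorDual_two_apply (g : GL3) : minorDual 2 g = g 0 0 * g 1 1 - g 0 1 * g 1 0 :=
  minor2_apply 0 1 g

theorem minor1_mul (g X : GL3) (i : Fin 3) :
    minor1 i (g * X) = ∑ k, minor1 k g * X k i := by
  simp [minor1, Matrix.mul_apply]

/-- The Cauchy–Binet formula for the first two rows, with column indices taken modulo 3. -/
theorem minorDual_mul (g X : GL3) (i : Fin 3) :
    minorDual i (g * X) = ∑ k : Fin 3, minorDual k g *
      (X (k + 1) (i + 1) * X (k + 2) (i + 2) - X (k + 1) (i + 2) * X (k + 2) (i + 1)) := by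
  simp only [minorDual, minor2_apply, Units.val_mul, Matrix.mul_apply, Fin.sum_univ_three]
  simp only [show (0 : Fin 3) + 1 = 1 from rfl, show (1 : Fin 3) + 1 = 2 from rfl,
    show (2 : Fin 3) + 1 = 0 from rfl, show (0 : Fin 3) + 2 = 2 from rfl,
    show (1 : Fin 3) + 2 = 0 from rfl, show (2 : Fin 3) + 2 = 1 from rfl]
  ring

/-- Laplace expansion of a determinant with a repeated first row. -/
theorem minor_relation (g : GL3) : minor1 0 g * minorDual 0 g + minor1 1 g * minorDual 1 g +
    minor1 2 g * minorDual 2 g = 0 := by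
  simp only [minorDual_zero_apply, minorDual_one_apply, minorDual_two_apply, minor1]
  ring

theorem sum_minor1_mul_minorDual : ∑ i, minor1 i * minorDual i = 0 := by
  ext g
  rw [Fin.sum_univ_three]
  exact minor_relation g

/-- The span of the entries of the first row. -/
def rowSpan : Submodule ℂ (GL3 → ℂ) := Submodule.span ℂ (Set.range minor1)

/-- The span of the minors of the first two rows. -/
def minorSpan : Submodule ℂ (GL3 → ℂ) := Submodule.span ℂ (Set.range minorDual)

/-- The functions that are polynomials, homogeneous of degree `p` in the entries of the first row
and homogeneous of degree `q` in the minors of the first two rows. -/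
def polyRep (p q : ℕ) : Submodule ℂ (GL3 → ℂ) := rowSpan ^ p * minorSpan ^ q

theorem minor1_mem_rowSpan (i : Fin 3) : minor1 i ∈ rowSpan := Submodule.subset_span ⟨i, rfl⟩

theorem minorDual_mem_minorSpan (i : Fin 3) : minorDual i ∈ minorSpan :=
  Submodule.subset_span ⟨i, rfl⟩

theorem irrep_le_polyRep (m₁ m₂ : ℕ) : irrep m₁ m₂ ≤ polyRep (m₁ - m₂) m₂ := by
  refine Submodule.span_le.mpr ?_
  rintro _ ⟨X, rfl⟩
  have h1 : (fun g => minor1 0 (g * X)) ∈ rowSpan := by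
    have : (fun g => minor1 0 (g * X)) = ∑ k, X k 0 • minor1 k := by
      ext g; simp [minor1_mul, mul_comm]
    rw [this]
    exact Submodule.sum_mem _ fun k _ => Submodule.smul_mem _ _ (minor1_mem_rowSpan k)
  have h2 : (fun g => minorDual 2 (g * X)) ∈ minorSpan := by
    have : (fun g => minorDual 2 (g * X)) = ∑ k : Fin 3,
        (X (k + 1) (2 + 1) * X (k + 2) (2 + 2) - X (k + 1) (2 + 2) * X (k + 2) (2 + 1)) •
          minorDual k := by
      ext g; simp only [minorDual_mul, Finset.sum_apply, Pi.smul_apply, smul_eq_mul, mul_comm]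
    rw [this]
    exact Submodule.sum_mem _ fun k _ => Submodule.smul_mem _ _ (minorDual_mem_minorSpan k)
  have h3 : (fun g => highestFun m₁ m₂ (g * X)) =
      (((m₁ - m₂).factorial : ℂ)⁻¹ * (m₂.factorial : ℂ)⁻¹) •
        ((fun g => minor1 0 (g * X)) ^ (m₁ - m₂) * (fun g => minorDual 2 (g * X)) ^ m₂) := by
    ext g
    simp only [highestFun, minorDual, Pi.smul_apply, Pi.mul_apply, Pi.pow_apply, smul_eq_mul,
      show (2 : Fin 3) + 1 = 0 from rfl, show (2 : Fin 3) + 2 = 1 from rfl]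
    ring
  change (fun g => highestFun m₁ m₂ (g * X)) ∈ polyRep (m₁ - m₂) m₂
  rw [h3]
  exact Submodule.smul_mem _ _ (Submodule.mul_mem_mul (Submodule.pow_mem_pow _ h1 _)
    (Submodule.pow_mem_pow _ h2 _))

/-- Incident `x` and `z` in general position are the first column of an invertible matrix and the
cross product of its first two columns. -/
theorem exists_GL3_of_incident {x z : Fin 3 → ℂ} (hx : x 2 ≠ 0) (hz : z 0 ≠ 0)
    (h : ∑ i, x i * z i = 0) : ∃ X : GL3, (∀ g, minor1 0 (g * X) = ∑ k, minor1 k g * x k) ∧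
      ∀ g, minorDual 2 (g * X) = ∑ k, minorDual k g * z k := by
  rw [Fin.sum_univ_three] at h
  -- The second column is chosen so that its cross product with `x` is `z`: the first two
  -- coordinates agree by construction, the last by incidence. The third column makes the
  -- determinant `z 0`.
  let M : Matrix (Fin 3) (Fin 3) ℂ := !![x 0, z 1 / x 2, 1; x 1, -z 0 / x 2, 0; x 2, 0, 0]
  have hM : M.det ≠ 0 := by
    have : M.det = z 0 := by
      rw [Matrix.det_fin_three]; simp [M]; field_simp
    rwa [this]
  refine ⟨Matrix.GeneralLinearGroup.mkOfDetNeZero M hM, fun g => ?_, fun g => ?_⟩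
  · rw [minor1_mul]
    simp [Fin.sum_univ_three, Matrix.GeneralLinearGroup.mkOfDetNeZero, M]
  · rw [minorDual_mul]
    have h2 : x 0 * (-z 0 / x 2) - z 1 / x 2 * x 1 = z 2 := by
      field_simp; linear_combination -h
    simp only [Fin.sum_univ_three]
    simp only [show (0 : Fin 3) + 1 = 1 from rfl, show (1 : Fin 3) + 1 = 2 from rfl,
      show (2 : Fin 3) + 1 = 0 from rfl, show (0 : Fin 3) + 2 = 2 from rfl,
      show (1 : Fin 3) + 2 = 0 from rfl, show (2 : Fin 3) + 2 = 1 from rfl]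
    simp [Matrix.GeneralLinearGroup.mkOfDetNeZero, M]
    rw [h2]
    field_simp

/-! ### The generating polynomial and duality. -/

section generating

open MvPolynomial

/-- The generic linear combination of the entries of the first row. -/
noncomputable def genericRow : MvPolynomial (Fin 3 ⊕ Fin 3) (GL3 → ℂ) :=
  ∑ i, C (minor1 i) * X (Sum.inl i)

/-- The generic linear combination of the minors of the first two rows. -/
noncomputable def genericMinor : MvPolynomial (Fin 3 ⊕ Fin 3) (GL3 → ℂ) :=
  ∑ i, C (minorDual i) * X (Sum.inr i)

theorem pderiv_inl_genericRow (i : Fin 3) : pderiv (Sum.inl i) genericRow = C (minor1 i) := by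
  simp [genericRow, pderiv_X, Pi.single_apply]

theorem pderiv_inr_genericRow (i : Fin 3) : pderiv (Sum.inr i) genericRow = 0 := by
  simp [genericRow, pderiv_X]

theorem pderiv_inl_genericMinor (i : Fin 3) : pderiv (Sum.inl i) genericMinor = 0 := by
  simp [genericMinor, pderiv_X]

theorem pderiv_inr_genericMinor (i : Fin 3) :
    pderiv (Sum.inr i) genericMinor = C (minorDual i) := by
  simp [genericMinor, pderiv_X, Pi.single_apply]

theorem genericRow_isHomogeneous : genericRow.IsHomogeneous 1 :=
  IsHomogeneous.sum _ _ _ fun _ _ => isHomogeneous_C_mul_X _ _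

theorem genericMinor_isHomogeneous : genericMinor.IsHomogeneous 1 :=
  IsHomogeneous.sum _ _ _ fun _ _ => isHomogeneous_C_mul_X _ _

/-- Differentiating each power once produces the common factor `∑ i, minor1 i * minorDual i`, which
is zero. -/
theorem incidenceLaplacian_generic (p q : ℕ) :
    incidenceLaplacian (genericRow ^ p * genericMinor ^ q) = 0 := by
  have h : ∀ i : Fin 3, pderiv (Sum.inl i) (pderiv (Sum.inr i) (genericRow ^ p * genericMinor ^ q))
      = (p * q : MvPolynomial (Fin 3 ⊕ Fin 3) (GL3 → ℂ)) * genericRow ^ (p - 1) *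
        genericMinor ^ (q - 1) * C (minor1 i * minorDual i) := fun i => by
    simp only [pderiv_mul, pderiv_pow, pderiv_inl_genericRow, pderiv_inr_genericRow,
      pderiv_inl_genericMinor, pderiv_inr_genericMinor, mul_zero, zero_mul, zero_add, add_zero,
      pderiv_C, Derivation.map_natCast, C_mul]
    ring
  rw [incidenceLaplacian, Finset.sum_congr rfl fun i _ => h i, ← Finset.mul_sum, ← map_sum,
    sum_minor1_mul_minorDual, map_zero, mul_zero]

variable {l : (GL3 → ℂ) →ₗ[ℂ] ℂ}

/-- At a generic incident point the value is `l` of a translate, hence zero; so the form divides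
this harmonic polynomial. -/
theorem coeffMap_generic_eq_zero {p q : ℕ}
    (hl : ∀ X : GL3, l (fun g => minor1 0 (g * X) ^ p * minorDual 2 (g * X) ^ q) = 0) :
    coeffMap l (genericRow ^ p * genericMinor ^ q) = 0 := by
  refine eq_zero_of_form_dvd_of_laplacian_eq_zero
    (IsHomogeneous.coeffMap l ((genericRow_isHomogeneous.pow p).mul
      (genericMinor_isHomogeneous.pow q))) (incidenceForm_dvd fun x z hx hz h => ?_) ?_
  · obtain ⟨X, h1, h2⟩ := exists_GL3_of_incident hx hz h
    rw [eval_coeffMap, ← hl X]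
    congr 1
    ext g
    rw [h1, h2]
    simp [genericRow, genericMinor]
  · simp only [incidenceLaplacian, pderiv_coeffMap, ← coeffMap_sum]
    rw [← coeffMap_zero l, ← incidenceLaplacian_generic p q]
    rfl

/-- Each derivative of the vanishing generating polynomial trades one generic factor for an
arbitrary row entry or minor, up to a nonzero integer. After `p + q` derivatives only the constant
`l u` remains. -/
theorem apply_eq_zero_of_mem_polyRep {p q : ℕ}
    (hl : ∀ X : GL3, l (fun g => minor1 0 (g * X) ^ p * minorDual 2 (g * X) ^ q) = 0)
    {u : GL3 → ℂ} (hu : u ∈ polyRep p q) : l u = 0 := by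
  have key1 : ∀ (a : GL3 → ℂ) (k m : ℕ),
      coeffMap l (C a * genericRow ^ (k + 1) * genericMinor ^ m) = 0 → ∀ v ∈ rowSpan,
      coeffMap l (C (v * a) * genericRow ^ k * genericMinor ^ m) = 0 := by
    intro a k m h v hv
    induction hv using Submodule.span_induction with
    | mem v hv =>
      obtain ⟨i, rfl⟩ := hv
      have h2 := pderiv_coeffMap l (Sum.inl i) (C a * genericRow ^ (k + 1) * genericMinor ^ m)
      have h3 : pderiv (Sum.inl i) (C a * genericRow ^ (k + 1) * genericMinor ^ m) =
          C (algebraMap ℂ (GL3 → ℂ) (k + 1)) *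
            (C (minor1 i * a) * genericRow ^ k * genericMinor ^ m) := by
        simp only [pderiv_mul, pderiv_pow, pderiv_inl_genericRow, pderiv_inl_genericMinor,
          pderiv_C, C_mul, map_add, map_natCast, map_one]
        push_cast
        ring
      rw [h, map_zero, h3, coeffMap_C_mul] at h2
      refine (mul_eq_zero.mp h2.symm).resolve_left ?_
      rw [C_eq_zero]; exact_mod_cast k.succ_ne_zero
    | zero => simp [coeffMap_zero]
    | add v w _ _ hv hw => rw [add_mul, C_add, add_mul, add_mul, coeffMap_add, hv, hw, add_zero]
    | smul c v _ hv =>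
      rw [Algebra.smul_def, mul_assoc _ v a, C_mul, mul_assoc (C _), mul_assoc (C _), coeffMap_C_mul, hv,
        mul_zero]
  have key2 : ∀ (a : GL3 → ℂ) (m : ℕ),
      coeffMap l (C a * genericMinor ^ (m + 1)) = 0 → ∀ v ∈ minorSpan,
      coeffMap l (C (v * a) * genericMinor ^ m) = 0 := by
    intro a m h v hv
    induction hv using Submodule.span_induction with
    | mem v hv =>
      obtain ⟨i, rfl⟩ := hv
      have h2 := pderiv_coeffMap l (Sum.inr i) (C a * genericMinor ^ (m + 1))
      have h3 : pderiv (Sum.inr i) (C a * genericMinor ^ (m + 1)) =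
          C (algebraMap ℂ (GL3 → ℂ) (m + 1)) * (C (minorDual i * a) * genericMinor ^ m) := by
        simp only [pderiv_mul, pderiv_pow, pderiv_inr_genericMinor,
          pderiv_C, C_mul, map_add, map_natCast, map_one]
        push_cast
        ring
      rw [h, map_zero, h3, coeffMap_C_mul] at h2
      refine (mul_eq_zero.mp h2.symm).resolve_left ?_
      rw [C_eq_zero]; exact_mod_cast m.succ_ne_zero
    | zero => simp [coeffMap_zero]
    | add v w _ _ hv hw => rw [add_mul, C_add, add_mul, coeffMap_add, hv, hw, add_zero]
    | smul c v _ hv =>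
      rw [Algebra.smul_def, mul_assoc _ v a, C_mul, mul_assoc (C _), coeffMap_C_mul, hv, mul_zero]
  have step1 : ∀ j k : ℕ, j + k = p → ∀ v ∈ rowSpan ^ j,
      coeffMap l (C v * genericRow ^ k * genericMinor ^ q) = 0 := by
    intro j
    induction j with
    | zero =>
      intro k hk v hv
      obtain rfl : k = p := by omega
      rw [pow_zero] at hv
      obtain ⟨c, rfl⟩ := Submodule.mem_one.mp hv
      rw [mul_assoc, coeffMap_C_mul, coeffMap_generic_eq_zero hl, mul_zero]
    | succ j ih =>
      intro k hk v hv
      rw [pow_succ'] at hv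
      induction hv using Submodule.mul_induction_on' with
      | mem_mul_mem a ha b hb => exact key1 b k q (ih (k + 1) (by omega) b hb) a ha
      | add a _ b _ ha hb => rw [C_add, add_mul, add_mul, coeffMap_add, ha, hb, add_zero]
  have step2 : ∀ j k : ℕ, j + k = q → ∀ v ∈ minorSpan ^ j * rowSpan ^ p,
      coeffMap l (C v * genericMinor ^ k) = 0 := by
    intro j
    induction j with
    | zero =>
      intro k hk v hv
      obtain rfl : k = q := by omega
      rw [pow_zero, one_mul] at hv
      simpa using step1 p 0 (by omega) v hv
    | succ j ih =>
      intro k hk v hv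
      rw [pow_succ', mul_assoc] at hv
      induction hv using Submodule.mul_induction_on' with
      | mem_mul_mem a ha b hb => exact key2 b k (ih (k + 1) (by omega) b hb) a ha
      | add a _ b _ ha hb => rw [C_add, add_mul, coeffMap_add, ha, hb, add_zero]
  rw [polyRep, mul_comm] at hu
  have := step2 q 0 (by omega) u hu
  rwa [pow_zero, mul_one, coeffMap_C, C_eq_zero] at this

end generating

/-- A function outside the span of the translates would be separated from it by a linear functional,
contrary to `apply_eq_zero_of_mem_polyRep`. -/
theorem irrep_eq_polyRep (m₁ m₂ : ℕ) : irrep m₁ m₂ = polyRep (m₁ - m₂) m₂ := by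
  refine le_antisymm (irrep_le_polyRep m₁ m₂) fun u hu => ?_
  by_contra hn
  obtain ⟨l, hl, hker⟩ := Submodule.exists_le_ker_of_notMem hn
  refine hl (apply_eq_zero_of_mem_polyRep (fun X => ?_) hu)
  have h1 := hker (Submodule.subset_span ⟨X, rfl⟩ : (fun g => highestFun m₁ m₂ (g * X)) ∈ irrep m₁ m₂)
  have h2 : (fun g => minor1 0 (g * X) ^ (m₁ - m₂) * minorDual 2 (g * X) ^ m₂) =
      (((m₁ - m₂).factorial : ℂ) * (m₂.factorial : ℂ)) • fun g => highestFun m₁ m₂ (g * X) := by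
    ext g
    have e1 : ((m₁ - m₂).factorial : ℂ) ≠ 0 := by exact_mod_cast Nat.factorial_ne_zero _
    have e2 : (m₂.factorial : ℂ) ≠ 0 := by exact_mod_cast Nat.factorial_ne_zero _
    simp only [highestFun, minorDual, Pi.smul_apply, smul_eq_mul,
      show (2 : Fin 3) + 1 = 0 from rfl, show (2 : Fin 3) + 2 = 1 from rfl]
    field_simp
  rw [h2, map_smul, LinearMap.mem_ker.mp h1, smul_zero]

/-! ### One-parameter subgroups and the infinitesimal action. -/

theorem coe_expGL (X : Matrix (Fin 3) (Fin 3) ℂ) :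
    (expGL X : Matrix (Fin 3) (Fin 3) ℂ) = NormedSpace.exp X := IsUnit.unit_spec _

theorem expGL_zero : expGL 0 = 1 := Units.ext (by rw [coe_expGL, NormedSpace.exp_zero]; rfl)

theorem expGL_add_smul (s t : ℂ) (X : Matrix (Fin 3) (Fin 3) ℂ) :
    expGL ((s + t) • X) = expGL (s • X) * expGL (t • X) := by
  refine Units.ext ?_
  rw [Units.val_mul, coe_expGL, coe_expGL, coe_expGL, add_smul]
  exact Matrix.exp_add_of_commute _ _ (((Commute.refl X).smul_left s).smul_right t)

theorem coe_expGL_smul_matE {i j : Fin 3} (hij : i ≠ j) (t : ℂ) :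
    (expGL (t • matE i j) : Matrix (Fin 3) (Fin 3) ℂ) = 1 + t • matE i j := by
  have h2 : (t • matE i j) ^ 2 = 0 := by
    rw [pow_two, smul_mul_smul, matE, Matrix.single_mul_single_of_ne _ _ _ _ hij.symm, smul_zero]
  rw [coe_expGL, NormedSpace.exp_eq_tsum ℂ]
  change ∑' n : ℕ, ((n.factorial : ℂ)⁻¹) • (t • matE i j) ^ n = _
  rw [tsum_eq_sum (s := Finset.range 2)]
  · simp [Finset.sum_range_succ]
  · intro n hn
    obtain ⟨k, rfl⟩ := Nat.exists_eq_add_of_le (not_lt.mp (fun h => hn (Finset.mem_range.mpr h)))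
    rw [pow_add, h2, zero_mul, smul_zero]

theorem coe_expGL_smul_matE_self (i : Fin 3) (t : ℂ) :
    (expGL (t • matE i i) : Matrix (Fin 3) (Fin 3) ℂ) =
      Matrix.diagonal (Pi.mulSingle i (Complex.exp t)) := by
  have h : t • matE i i = Matrix.diagonal (Pi.single i t) := by
    rw [matE, Matrix.smul_single, smul_eq_mul, mul_one, Matrix.diagonal_single]
  rw [coe_expGL, h, Matrix.exp_diagonal]
  congr 1
  ext k
  rw [Pi.coe_exp]
  rcases eq_or_ne k i with rfl | hk
  · simp [Complex.exp_eq_exp_ℂ]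
  · simp [hk]

/-- The group law carries the vanishing derivative at `t = 0`, known at every base point, to all
`t`; the function is then constant along the subgroup. -/
theorem isLieImage_zero_iff {X : Matrix (Fin 3) (Fin 3) ℂ} {F : GL3 × GL3 → ℂ} :
    IsLieImage X F 0 ↔
      ∀ (a b : GL3) (t : ℂ), F (a * expGL (t • X), b * expGL (t • X)) = F (a, b) := by
  constructor
  · intro h a b t
    have hd : ∀ s : ℂ, HasDerivAt (fun t : ℂ => F (a * expGL (t • X), b * expGL (t • X))) 0 s := by
      intro s
      have h1 := h (a * expGL (s • X)) (b * expGL (s • X))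
      have h2 : (fun t : ℂ => F (a * expGL (t • X), b * expGL (t • X))) =
          fun t => (fun t : ℂ => F (a * expGL (s • X) * expGL (t • X),
            b * expGL (s • X) * expGL (t • X))) (t - s) := by
        ext t
        simp only [mul_assoc, ← expGL_add_smul, add_sub_cancel]
      rw [h2]
      refine HasDerivAt.comp_sub_const (f := fun t : ℂ => F (a * expGL (s • X) * expGL (t • X),
            b * expGL (s • X) * expGL (t • X))) s s ?_
      rw [sub_self]
      exact h1
    have h3 := is_const_of_deriv_eq_zero (fun s => (hd s).differentiableAt)
      (fun s => (hd s).deriv) t 0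
    simpa [expGL_zero] using h3
  · intro h a b
    simp only [h]
    exact hasDerivAt_const _ _

/-- Each factor of `fVec` is multiplied by a character of the upper triangular group. Unipotent
matrices give highest vectors and diagonal ones give the weights. -/
theorem fVec_mul_of_upper (e : Exponents) (a b X : GL3) (h10 : X 1 0 = 0) (h20 : X 2 0 = 0)
    (h21 : X 2 1 = 0) : fVec e (a * X, b * X) =
      X 0 0 ^ (e.α + e.β + e.γ + e.δ + e.ω + e.φ + e.ψ + 2 * e.θ) *
        X 1 1 ^ (e.γ + e.δ + e.ω + e.φ + e.ψ + e.θ) * X 2 2 ^ (e.φ + e.ψ + e.θ) *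
        fVec e (a, b) := by
  have k1 : ∀ g : GL3, minor1 0 (g * X) = X 0 0 * minor1 0 g := fun g => by
    simp [minor1, Matrix.mul_apply, Fin.sum_univ_three, h10, h20, mul_comm]
  have k2 : ∀ g : GL3, minor2 0 1 (g * X) = X 0 0 * X 1 1 * minor2 0 1 g := fun g => by
    simp only [minor2_apply, Units.val_mul, Matrix.mul_apply, Fin.sum_univ_three, h10, h20, h21]
    ring
  have k3 : ab12 (a * X) (b * X) = X 0 0 * X 1 1 * ab12 a b := by
    simp only [ab12, Matrix.det_fin_two_of, Units.val_mul, Matrix.mul_apply, Fin.sum_univ_three,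
      h10, h20, h21]
    ring
  have k4 : abb (a * X) (b * X) = X 0 0 * X 1 1 * X 2 2 * abb a b := by
    simp only [abb, Matrix.det_fin_three, Matrix.of_apply, Matrix.cons_val, Units.val_mul,
      Matrix.mul_apply, Fin.sum_univ_three, h10, h20, h21]
    ring
  have k5 : aab (a * X) (b * X) = X 0 0 * X 1 1 * X 2 2 * aab a b := by
    simp only [aab, Matrix.det_fin_three, Matrix.of_apply, Matrix.cons_val, Units.val_mul,
      Matrix.mul_apply, Fin.sum_univ_three, h10, h20, h21]
    ring
  have k6 : aabb1213 (a * X) (b * X) = X 0 0 ^ 2 * X 1 1 * X 2 2 * aabb1213 a b := by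
    simp only [aabb1213, minor2_apply, Units.val_mul, Matrix.mul_apply, Fin.sum_univ_three,
      h10, h20, h21]
    ring
  simp only [fVec, k1, k2, k3, k4, k5, k6]
  ring

theorem fVec_isLieImage_matE_zero (e : Exponents) {i j : Fin 3} (hij : i < j) :
    IsLieImage (matE i j) (fVec e) 0 := by
  rw [isLieImage_zero_iff]
  intro a b t
  have hX := coe_expGL_smul_matE hij.ne t
  rw [fVec_mul_of_upper]
  · rw [hX]
    simp only [Matrix.add_apply, Matrix.smul_apply, matE, Matrix.single_apply]
    have h0 : ∀ k : Fin 3, ¬ (i = k ∧ j = k) := fun k h => hij.ne (h.1.trans h.2.symm)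
    simp [h0]
  all_goals
    rw [hX]
    revert hij
    fin_cases i <;> fin_cases j <;> simp [matE]

theorem fVec_isLieImage_matE_self (e : Exponents) : ∃ μ : Fin 3 → ℂ, ∀ i : Fin 3,
    IsLieImage (matE i i) (fVec e) (μ i • fVec e) := by
  have key : ∀ i : Fin 3, ∃ n : ℕ, IsLieImage (matE i i) (fVec e) ((n : ℂ) • fVec e) := by
    intro i
    let w : Fin 3 → ℕ := ![e.α + e.β + e.γ + e.δ + e.ω + e.φ + e.ψ + 2 * e.θ,
      e.γ + e.δ + e.ω + e.φ + e.ψ + e.θ, e.φ + e.ψ + e.θ]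
    refine ⟨w i, fun a b => ?_⟩
    have h : (fun t : ℂ => fVec e (a * expGL (t • matE i i), b * expGL (t • matE i i))) =
        fun t => Complex.exp (w i * t) * fVec e (a, b) := by
      ext t
      have hX := coe_expGL_smul_matE_self i t
      rw [fVec_mul_of_upper, hX, Complex.exp_nat_mul]
      · fin_cases i <;> simp [w]
      all_goals
        rw [hX]
        simp
    rw [h]
    have h1 : HasDerivAt (fun t : ℂ => Complex.exp (w i * t)) (Complex.exp (w i * 0) * (w i * 1)) 0 :=
      ((hasDerivAt_id (0 : ℂ)).const_mul (w i : ℂ)).cexp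
    simpa using h1.mul_const (fVec e (a, b))
  choose n hn using key
  exact ⟨fun i => n i, hn⟩

/-! ### Invariance under the upper unitriangular group. -/

/-- The upper unitriangular matrix with the entries `y, w, v` above the diagonal. -/
noncomputable def upperUni (y w v : ℂ) : GL3 :=
  Matrix.GeneralLinearGroup.mkOfDetNeZero !![1, y, w; 0, 1, v; 0, 0, 1] (by
    simp [Matrix.det_fin_three])

theorem coe_upperUni (y w v : ℂ) :
    (upperUni y w v : Matrix (Fin 3) (Fin 3) ℂ) = !![1, y, w; 0, 1, v; 0, 0, 1] := rfl

theorem upperUni_mul (y w v y' w' v' : ℂ) : upperUni y w v * upperUni y' w' v' =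
    upperUni (y + y') (w + y * v' + w') (v + v') := by
  refine Units.ext ?_
  rw [Units.val_mul, coe_upperUni, coe_upperUni, coe_upperUni]
  ext i j
  fin_cases i <;> fin_cases j <;> simp [Matrix.mul_apply, Fin.sum_univ_three] <;> ring

theorem upperUni_zero : upperUni 0 0 0 = 1 := by
  refine Units.ext ?_
  rw [coe_upperUni]
  ext i j
  fin_cases i <;> fin_cases j <;> rfl

theorem expGL_smul_matE_eq_upperUni (t : ℂ) :
    expGL (t • matE 0 1) = upperUni t 0 0 ∧ expGL (t • matE 0 2) = upperUni 0 t 0 ∧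
      expGL (t • matE 1 2) = upperUni 0 0 t := by
  refine ⟨?_, ?_, ?_⟩ <;>
  · refine Units.ext ?_
    rw [coe_expGL_smul_matE (by decide), coe_upperUni]
    ext i j
    fin_cases i <;> fin_cases j <;> simp [matE]

theorem apply_mul_upperUni {F : GL3 × GL3 → ℂ}
    (hF : ∀ i j : Fin 3, i < j → IsLieImage (matE i j) F 0) (a b : GL3) (y w v : ℂ) :
    F (a * upperUni y w v, b * upperUni y w v) = F (a, b) := by
  have h : upperUni y w v = upperUni 0 0 v * upperUni 0 w 0 * upperUni y 0 0 := by
    simp [upperUni_mul]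
  have h1 := isLieImage_zero_iff.mp (hF 0 1 (by decide))
  have h2 := isLieImage_zero_iff.mp (hF 0 2 (by decide))
  have h3 := isLieImage_zero_iff.mp (hF 1 2 (by decide))
  simp only [expGL_smul_matE_eq_upperUni] at h1 h2 h3
  rw [h, ← mul_assoc, ← mul_assoc, ← mul_assoc, ← mul_assoc, h1, h2, h3]

/-! ### Functions of two matrices. -/

section tensor

/-- Pull-back along the first projection. -/
def pullFst : (GL3 → ℂ) →ₐ[ℂ] (GL3 × GL3 → ℂ) where
  toFun u p := u p.1
  map_one' := rfl
  map_mul' _ _ := rfl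
  map_zero' := rfl
  map_add' _ _ := rfl
  commutes' _ := rfl

/-- Pull-back along the second projection. -/
def pullSnd : (GL3 → ℂ) →ₐ[ℂ] (GL3 × GL3 → ℂ) where
  toFun u p := u p.2
  map_one' := rfl
  map_mul' _ _ := rfl
  map_zero' := rfl
  map_add' _ _ := rfl
  commutes' _ := rfl

theorem pullFst_apply (u : GL3 → ℂ) (p : GL3 × GL3) : pullFst u p = u p.1 := rfl

theorem pullSnd_apply (u : GL3 → ℂ) (p : GL3 × GL3) : pullSnd u p = u p.2 := rfl

theorem ab12_eq (a b : GL3) : ab12 a b = minor1 0 a * minor1 1 b - minor1 1 a * minor1 0 b := by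
  simp [ab12, minor1, Matrix.det_fin_two_of]

theorem abb_eq (a b : GL3) : abb a b = ∑ i, minor1 i a * minorDual i b := by
  simp only [abb, Matrix.det_fin_three, Matrix.of_apply, Matrix.cons_val, Fin.sum_univ_three,
    minor1, minorDual_zero_apply, minorDual_one_apply, minorDual_two_apply]
  ring

theorem aab_eq (a b : GL3) : aab a b = ∑ i, minorDual i a * minor1 i b := by
  simp only [aab, Matrix.det_fin_three, Matrix.of_apply, Matrix.cons_val, Fin.sum_univ_three,
    minor1, minorDual_zero_apply, minorDual_one_apply, minorDual_two_apply]
  ring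

theorem aabb1213_eq (a b : GL3) :
    aabb1213 a b = minorDual 1 a * minorDual 2 b - minorDual 2 a * minorDual 1 b := by
  simp only [aabb1213, minor2_apply, minorDual_one_apply, minorDual_two_apply]
  ring

/-- The functions of two matrices that are polynomials of the given degrees in the entries of the
first row of the first matrix, in its minors of the first two rows, and likewise for the second
matrix. -/
def polyPair (p q r s : ℕ) : Submodule ℂ (GL3 × GL3 → ℂ) :=
  (rowSpan.map pullFst.toLinearMap) ^ p * (minorSpan.map pullFst.toLinearMap) ^ q *
    ((rowSpan.map pullSnd.toLinearMap) ^ r * (minorSpan.map pullSnd.toLinearMap) ^ s)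

theorem polyPair_le_tensorFun (p q r s : ℕ) :
    polyPair p q r s ≤ tensorFun (polyRep p q) (polyRep r s) := by
  rw [polyPair, ← Submodule.map_pow, ← Submodule.map_pow, ← Submodule.map_pow, ← Submodule.map_pow,
    ← Submodule.map_mul, ← Submodule.map_mul, Submodule.mul_le]
  rintro _ ⟨u, hu, rfl⟩ _ ⟨v, hv, rfl⟩
  exact Submodule.subset_span ⟨u, hu, v, hv, rfl⟩

theorem fVec_mem_polyPair (e : Exponents) : fVec e ∈
    polyPair (e.α + e.ω + e.φ) (e.γ + e.θ + e.ψ) (e.β + e.ω + e.ψ) (e.δ + e.φ + e.θ) := by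
  have a1 : ∀ i, pullFst (minor1 i) ∈ rowSpan.map pullFst.toLinearMap := fun i =>
    Submodule.mem_map_of_mem (f := pullFst.toLinearMap) (minor1_mem_rowSpan i)
  have a2 : ∀ i, pullFst (minorDual i) ∈ minorSpan.map pullFst.toLinearMap := fun i =>
    Submodule.mem_map_of_mem (f := pullFst.toLinearMap) (minorDual_mem_minorSpan i)
  have b1 : ∀ i, pullSnd (minor1 i) ∈ rowSpan.map pullSnd.toLinearMap := fun i =>
    Submodule.mem_map_of_mem (f := pullSnd.toLinearMap) (minor1_mem_rowSpan i)
  have b2 : ∀ i, pullSnd (minorDual i) ∈ minorSpan.map pullSnd.toLinearMap := fun i =>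
    Submodule.mem_map_of_mem (f := pullSnd.toLinearMap) (minorDual_mem_minorSpan i)
  have h : fVec e = pullFst (minor1 0) ^ e.α * pullSnd (minor1 0) ^ e.β *
      pullFst (minorDual 2) ^ e.γ * pullSnd (minorDual 2) ^ e.δ *
      (pullFst (minor1 0) * pullSnd (minor1 1) - pullFst (minor1 1) * pullSnd (minor1 0)) ^ e.ω *
      (∑ i, pullFst (minor1 i) * pullSnd (minorDual i)) ^ e.φ *
      (∑ i, pullFst (minorDual i) * pullSnd (minor1 i)) ^ e.ψ *
      (pullFst (minorDual 1) * pullSnd (minorDual 2) -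
        pullFst (minorDual 2) * pullSnd (minorDual 1)) ^ e.θ := by
    ext ⟨a, b⟩
    simp only [fVec, ab12_eq, abb_eq, aab_eq, aabb1213_eq, Pi.mul_apply, Pi.pow_apply, Pi.sub_apply,
      Finset.sum_apply, pullFst_apply, pullSnd_apply]
    rfl
  have hS : polyPair (e.α + e.ω + e.φ) (e.γ + e.θ + e.ψ) (e.β + e.ω + e.ψ) (e.δ + e.φ + e.θ) =
      (rowSpan.map pullFst.toLinearMap) ^ e.α * (rowSpan.map pullSnd.toLinearMap) ^ e.β *
      (minorSpan.map pullFst.toLinearMap) ^ e.γ * (minorSpan.map pullSnd.toLinearMap) ^ e.δ *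
      (rowSpan.map pullFst.toLinearMap * rowSpan.map pullSnd.toLinearMap) ^ e.ω *
      (rowSpan.map pullFst.toLinearMap * minorSpan.map pullSnd.toLinearMap) ^ e.φ *
      (minorSpan.map pullFst.toLinearMap * rowSpan.map pullSnd.toLinearMap) ^ e.ψ *
      (minorSpan.map pullFst.toLinearMap * minorSpan.map pullSnd.toLinearMap) ^ e.θ := by
    rw [polyPair]
    generalize rowSpan.map pullFst.toLinearMap = A
    generalize minorSpan.map pullFst.toLinearMap = B
    generalize rowSpan.map pullSnd.toLinearMap = C
    generalize minorSpan.map pullSnd.toLinearMap = D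
    ring
  rw [h, hS]
  refine Submodule.mul_mem_mul (Submodule.mul_mem_mul (Submodule.mul_mem_mul
    (Submodule.mul_mem_mul (Submodule.mul_mem_mul (Submodule.mul_mem_mul (Submodule.mul_mem_mul
      (Submodule.pow_mem_pow _ (a1 0) _) (Submodule.pow_mem_pow _ (b1 0) _))
      (Submodule.pow_mem_pow _ (a2 2) _)) (Submodule.pow_mem_pow _ (b2 2) _))
      (Submodule.pow_mem_pow _ ?_ _)) (Submodule.pow_mem_pow _ ?_ _))
      (Submodule.pow_mem_pow _ ?_ _)) (Submodule.pow_mem_pow _ ?_ _)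
  · exact Submodule.sub_mem _ (Submodule.mul_mem_mul (a1 0) (b1 1))
      (Submodule.mul_mem_mul (a1 1) (b1 0))
  · exact Submodule.sum_mem _ fun i _ => Submodule.mul_mem_mul (a1 i) (b2 i)
  · exact Submodule.sum_mem _ fun i _ => Submodule.mul_mem_mul (a2 i) (b1 i)
  · exact Submodule.sub_mem _ (Submodule.mul_mem_mul (a2 1) (b2 2))
      (Submodule.mul_mem_mul (a2 2) (b2 1))

theorem fVec_mem_tensorFun {m₁ m₂ n₁ n₂ : ℕ} {e : Exponents} (he : e.Admissible m₁ m₂ n₁ n₂) :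
    fVec e ∈ tensorFun (polyRep (m₁ - m₂) m₂) (polyRep (n₁ - n₂) n₂) := by
  obtain ⟨h1, h2, h3, h4⟩ := he
  have h := polyPair_le_tensorFun _ _ _ _ (fVec_mem_polyPair e)
  rwa [h1, h2, h3, h4] at h

theorem slice_mem_polyRep {p q r s : ℕ} {F : GL3 × GL3 → ℂ}
    (hF : F ∈ tensorFun (polyRep p q) (polyRep r s)) :
    (∀ a, (fun b => F (a, b)) ∈ polyRep r s) ∧ ∀ b, (fun a => F (a, b)) ∈ polyRep p q := by
  induction hF using Submodule.span_induction with
  | mem F hF =>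
    obtain ⟨u, hu, v, hv, rfl⟩ := hF
    refine ⟨fun a => Submodule.smul_mem _ (u a) hv, fun b => ?_⟩
    simp only [mul_comm _ (v b)]
    exact Submodule.smul_mem _ (v b) hu
  | zero => exact ⟨fun _ => Submodule.zero_mem _, fun _ => Submodule.zero_mem _⟩
  | add F G _ _ hF hG =>
    exact ⟨fun a => Submodule.add_mem _ (hF.1 a) (hG.1 a),
      fun b => Submodule.add_mem _ (hF.2 b) (hG.2 b)⟩
  | smul c F _ hF =>
    exact ⟨fun a => Submodule.smul_mem _ c (hF.1 a), fun b => Submodule.smul_mem _ c (hF.2 b)⟩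

end tensor

/-! ### Comparison of leading coefficients. -/

section leading

open Polynomial in
theorem coeff_X_pow_mul_linear_pow (v w : ℂ) {ω φ N : ℕ} (h : ω + φ ≤ N) :
    (X ^ ω * (C v * X - C w) ^ φ : ℂ[X]).coeff N = if ω + φ = N then v ^ φ else 0 := by
  have h1 : (C v * X - C w : ℂ[X]).natDegree ≤ 1 := by
    rw [sub_eq_add_neg, ← C_neg]; exact natDegree_linear_le
  have h2 : ((C v * X - C w) ^ φ : ℂ[X]).natDegree ≤ φ := by
    simpa using natDegree_pow_le_of_le φ h1
  split_ifs with hN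
  · rw [← hN, coeff_mul_add_eq_of_natDegree_le (natDegree_X_pow_le ω) h2, coeff_X_pow_self, one_mul]
    have := coeff_pow_of_natDegree_le (m := φ) h1
    rw [mul_one] at this
    rw [this]
    simp [coeff_C]
  · refine coeff_eq_zero_of_natDegree_lt (lt_of_le_of_lt (natDegree_mul_le_of_le
      (natDegree_X_pow_le ω) h2) (by omega))

/-- If a combination of the polynomials `y^ω (y v - w)^φ w^ψ v^θ` with `ω θ = 0` has degree less
than `K` in `y`, then so has each of its terms. -/
theorem coeff_eq_zero_of_degree_lt {ι : Type*} (s : Finset ι) (c : ι → ℂ) (ω φ ψ θ : ι → ℕ)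
    (hinj : ∀ i ∈ s, ∀ j ∈ s, ω i = ω j → φ i = φ j → ψ i = ψ j → θ i = θ j → i = j)
    (hst : ∀ i ∈ s, ω i = 0 ∨ θ i = 0) (K : ℕ)
    (h : ∀ w v : ℂ, ∃ P : Polynomial ℂ, P.degree < K ∧ ∀ y : ℂ,
      ∑ i ∈ s, c i * (y ^ ω i * (y * v - w) ^ φ i * w ^ ψ i * v ^ θ i) = P.eval y) :
    ∀ i ∈ s, K ≤ ω i + φ i → c i = 0 := by
  classical
  by_contra! hcon
  obtain ⟨i₀, hi₀, hi₀K, hi₀c⟩ := hcon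
  obtain ⟨j, hj, hmax⟩ := Finset.exists_max_image (s.filter fun i => c i ≠ 0) (fun i => ω i + φ i)
    ⟨i₀, Finset.mem_filter.mpr ⟨hi₀, hi₀c⟩⟩
  rw [Finset.mem_filter] at hj
  have hjK : K ≤ ω j + φ j := hi₀K.trans (hmax i₀ (Finset.mem_filter.mpr ⟨hi₀, hi₀c⟩))
  have hle : ∀ i ∈ s, c i ≠ 0 → ω i + φ i ≤ ω j + φ j := fun i hi hc =>
    hmax i (Finset.mem_filter.mpr ⟨hi, hc⟩)
  -- The coefficient of `y` in the largest degree that occurs with a nonzero `c i`.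
  have hlead : ∀ w v : ℂ, ∑ i ∈ s with ω i + φ i = ω j + φ j, c i * (w ^ ψ i * v ^ (φ i + θ i)) = 0 := by
    intro w v
    obtain ⟨P, hP, hy⟩ := h w v
    have hPeq : P = ∑ i ∈ s, Polynomial.C (c i * (w ^ ψ i * v ^ θ i)) *
        (Polynomial.X ^ ω i * (Polynomial.C v * Polynomial.X - Polynomial.C w) ^ φ i) := by
      refine Polynomial.funext fun y => ?_
      rw [← hy, Polynomial.eval_finsetSum]
      refine Finset.sum_congr rfl fun i _ => ?_
      simp only [Polynomial.eval_mul, Polynomial.eval_C, Polynomial.eval_pow, Polynomial.eval_X,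
        Polynomial.eval_sub]
      ring
    have h0 : P.coeff (ω j + φ j) = 0 :=
      Polynomial.coeff_eq_zero_of_degree_lt (hP.trans_le (by exact_mod_cast hjK))
    rw [hPeq, Polynomial.finsetSum_coeff] at h0
    rw [Finset.sum_filter]
    refine Eq.trans ?_ h0
    refine Finset.sum_congr rfl fun i hi => ?_
    rw [Polynomial.coeff_C_mul]
    by_cases hc : c i = 0
    · rw [hc]; simp
    rw [coeff_X_pow_mul_linear_pow v w (hle i hi hc)]
    split_ifs
    · ring
    · rw [mul_zero]
  let m : ι → (Fin 2 →₀ ℕ) := fun i => Finsupp.single 0 (ψ i) + Finsupp.single 1 (φ i + θ i)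
  have hpoly : ∑ i ∈ s with ω i + φ i = ω j + φ j, MvPolynomial.monomial (m i) (c i) = 0 := by
    refine MvPolynomial.funext fun x => ?_
    rw [map_sum, map_zero, ← hlead (x 0) (x 1)]
    refine Finset.sum_congr rfl fun i _ => ?_
    rw [MvPolynomial.eval_monomial, Finsupp.prod_fintype _ _ (by simp), Fin.prod_univ_two]
    simp [m]
  have hmem : j ∈ s.filter fun i => ω i + φ i = ω j + φ j := Finset.mem_filter.mpr ⟨hj.1, rfl⟩
  have hcoeff := congrArg (MvPolynomial.coeff (m j)) hpoly
  rw [MvPolynomial.coeff_sum, MvPolynomial.coeff_zero, Finset.sum_eq_single_of_mem j hmem] at hcoeff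
  · rw [MvPolynomial.coeff_monomial, if_pos rfl] at hcoeff
    exact hj.2 hcoeff
  · intro i hi hij
    rw [Finset.mem_filter] at hi
    rw [MvPolynomial.coeff_monomial, if_neg]
    intro hm
    have h1 : ψ i = ψ j := by simpa [m] using DFunLike.congr_fun hm 0
    have h2 : φ i + θ i = φ j + θ j := by simpa [m] using DFunLike.congr_fun hm 1
    have h3 := hi.2
    have h4 := hst i hi.1
    have h5 := hst j hj.1
    -- The leading monomials determine `ω + φ`, `ψ` and `φ + θ`, hence `ω - θ`; as one of `ω`, `θ`
    -- is zero, all four exponents are recovered.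
    exact hij (hinj i hi.1 j hj.1 (by omega) (by omega) h1 (by omega))

end leading

/-! ### Restriction to `a = 1` and standard monomials. -/

theorem minor1_one (i : Fin 3) : minor1 i 1 = if i = 0 then 1 else 0 := by
  fin_cases i <;> simp [minor1]

theorem minorDual_one (i : Fin 3) : minorDual i 1 = if i = 2 then 1 else 0 := by
  fin_cases i <;> simp [minorDual_zero_apply, minorDual_one_apply, minorDual_two_apply]

/-- The exponents `α` and `γ` disappear, and the other six become exponents of the six coordinates
of `b`. -/
theorem fVec_one_apply (e : Exponents) (b : GL3) : fVec e (1, b) =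
    minor1 0 b ^ e.β * minorDual 2 b ^ e.δ * minor1 1 b ^ e.ω * minorDual 0 b ^ e.φ *
      minor1 2 b ^ e.ψ * (-minorDual 1 b) ^ e.θ := by
  have h1 : minor2 0 1 1 = 1 := minorDual_one 2
  simp only [fVec, ab12_eq, abb_eq, aab_eq, aabb1213_eq, Fin.sum_univ_three, minor1_one,
    minorDual_one, h1]
  simp [minorDual]

theorem fVec_one_upperUni (e : Exponents) (y w v : ℂ) : fVec e (1, upperUni y w v) =
    y ^ e.ω * (y * v - w) ^ e.φ * w ^ e.ψ * v ^ e.θ := by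
  rw [fVec_one_apply]
  simp [minor1, minorDual_zero_apply, minorDual_one_apply, minorDual_two_apply, coe_upperUni]

section monomials

/-- The exponents of the monomials of degree `r` in the entries of the first row and of degree `s`
in the minors. -/
def monomialExponents (r s : ℕ) : Set Exponents :=
  {e | e.α = 0 ∧ e.γ = 0 ∧ e.β + e.ω + e.ψ = r ∧ e.δ + e.φ + e.θ = s}

/-- The exponents of the standard monomials. -/
def standardExponents (r s : ℕ) : Set Exponents :=
  {e | e ∈ monomialExponents r s ∧ (e.ω = 0 ∨ e.θ = 0)}

theorem rowSpan_mul_monomials_le (r s : ℕ) :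
    rowSpan * Submodule.span ℂ ((fun e b => fVec e (1, b)) '' monomialExponents r s) ≤
      Submodule.span ℂ ((fun e b => fVec e (1, b)) '' monomialExponents (r + 1) s) := by
  rw [rowSpan, Submodule.span_mul_span, Submodule.span_le]
  rintro _ ⟨_, ⟨i, rfl⟩, _, ⟨e, ⟨h1, h2, h3, h4⟩, rfl⟩, rfl⟩
  obtain rfl | rfl | rfl : i = 0 ∨ i = 1 ∨ i = 2 := by fin_cases i <;> simp
  · refine Submodule.subset_span ⟨{ e with β := e.β + 1 }, ⟨h1, h2, ?_, h4⟩, ?_⟩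
    · dsimp only; omega
    · ext b; simp only [fVec_one_apply, Pi.mul_apply]; ring
  · refine Submodule.subset_span ⟨{ e with ω := e.ω + 1 }, ⟨h1, h2, ?_, h4⟩, ?_⟩
    · dsimp only; omega
    · ext b; simp only [fVec_one_apply, Pi.mul_apply]; ring
  · refine Submodule.subset_span ⟨{ e with ψ := e.ψ + 1 }, ⟨h1, h2, ?_, h4⟩, ?_⟩
    · dsimp only; omega
    · ext b; simp only [fVec_one_apply, Pi.mul_apply]; ring

theorem minorSpan_mul_monomials_le (r s : ℕ) :
    minorSpan * Submodule.span ℂ ((fun e b => fVec e (1, b)) '' monomialExponents r s) ≤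
      Submodule.span ℂ ((fun e b => fVec e (1, b)) '' monomialExponents r (s + 1)) := by
  rw [minorSpan, Submodule.span_mul_span, Submodule.span_le]
  rintro _ ⟨_, ⟨i, rfl⟩, _, ⟨e, ⟨h1, h2, h3, h4⟩, rfl⟩, rfl⟩
  obtain rfl | rfl | rfl : i = 0 ∨ i = 1 ∨ i = 2 := by fin_cases i <;> simp
  · refine Submodule.subset_span ⟨{ e with φ := e.φ + 1 }, ⟨h1, h2, h3, ?_⟩, ?_⟩
    · dsimp only; omega
    · ext b; simp only [fVec_one_apply, Pi.mul_apply]; ring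
  · refine (Submodule.neg_mem_iff _).mp (Submodule.subset_span
      ⟨{ e with θ := e.θ + 1 }, ⟨h1, h2, h3, ?_⟩, ?_⟩)
    · dsimp only; omega
    · ext b; simp only [fVec_one_apply, Pi.mul_apply, Pi.neg_apply]; ring
  · refine Submodule.subset_span ⟨{ e with δ := e.δ + 1 }, ⟨h1, h2, h3, ?_⟩, ?_⟩
    · dsimp only; omega
    · ext b; simp only [fVec_one_apply, Pi.mul_apply]; ring

theorem polyRep_le_span_monomials (r s : ℕ) :
    polyRep r s ≤ Submodule.span ℂ ((fun e b => fVec e (1, b)) '' monomialExponents r s) := by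
  rw [polyRep]
  induction r with
  | zero =>
    rw [pow_zero, one_mul]
    induction s with
    | zero =>
      rw [pow_zero, Submodule.one_le]
      refine Submodule.subset_span ⟨⟨0, 0, 0, 0, 0, 0, 0, 0⟩, ⟨rfl, rfl, rfl, rfl⟩, ?_⟩
      ext b; simp [fVec_one_apply]
    | succ s ih =>
      rw [pow_succ']
      exact (mul_le_mul_right ih _).trans (minorSpan_mul_monomials_le 0 s)
  | succ r ih =>
    rw [pow_succ', mul_assoc]
    exact (mul_le_mul_right ih _).trans (rowSpan_mul_monomials_le r s)

/-- Straightening: `minor_relation` replaces the product of `minor1 1` and `-minorDual 1` by a sum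
of two other products, lowering both `ω` and `θ` by one. -/
theorem monomial_mem_span_standard {r s : ℕ} (n : ℕ) : ∀ e ∈ monomialExponents r s, e.ω = n →
    (fun b => fVec e (1, b)) ∈
      Submodule.span ℂ ((fun e b => fVec e (1, b)) '' standardExponents r s) := by
  induction n with
  | zero => exact fun e he hω => Submodule.subset_span ⟨e, ⟨he, Or.inl hω⟩, rfl⟩
  | succ n ih =>
    intro e he hω
    rcases Nat.eq_zero_or_pos e.θ with hθ | hθ
    · exact Submodule.subset_span ⟨e, ⟨he, Or.inr hθ⟩, rfl⟩
    obtain ⟨k, hk⟩ : ∃ k, e.θ = k + 1 := ⟨e.θ - 1, by omega⟩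
    obtain ⟨h1, h2, h3, h4⟩ := he
    have hsum : (fun b => fVec e (1, b)) =
        (fun b => fVec { e with ω := n, θ := k, β := e.β + 1, φ := e.φ + 1 } (1, b)) +
          fun b => fVec { e with ω := n, θ := k, ψ := e.ψ + 1, δ := e.δ + 1 } (1, b) := by
      ext b
      simp only [Pi.add_apply, fVec_one_apply, hω, hk]
      linear_combination (-(minor1 0 b ^ e.β * minorDual 2 b ^ e.δ * minor1 1 b ^ n *
        minorDual 0 b ^ e.φ * minor1 2 b ^ e.ψ * (-minorDual 1 b) ^ k)) * minor_relation b
    rw [hsum]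
    refine Submodule.add_mem _ (ih _ ⟨h1, h2, ?_, ?_⟩ rfl) (ih _ ⟨h1, h2, ?_, ?_⟩ rfl) <;>
    · dsimp only; omega

theorem polyRep_le_span_standard (r s : ℕ) :
    polyRep r s ≤ Submodule.span ℂ ((fun e b => fVec e (1, b)) '' standardExponents r s) := by
  refine (polyRep_le_span_monomials r s).trans (Submodule.span_le.mpr ?_)
  rintro _ ⟨e, he, rfl⟩
  exact monomial_mem_span_standard e.ω e he rfl

end monomials

/-! ### Degrees along curves. -/

section curves

/-- The functions that are polynomials of degree at most `n` along a curve. -/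
def polyCurve (γ : ℂ → GL3) (n : ℕ) : Submodule ℂ (GL3 → ℂ) where
  carrier := {u | ∃ P : Polynomial ℂ, P.natDegree ≤ n ∧ ∀ t, u (γ t) = P.eval t}
  zero_mem' := ⟨0, by simp, by simp⟩
  add_mem' := by
    rintro u v ⟨P, hP, hu⟩ ⟨Q, hQ, hv⟩
    exact ⟨P + Q, Polynomial.natDegree_add_le_of_degree_le hP hQ, fun t => by simp [hu, hv]⟩
  smul_mem' := by
    rintro c u ⟨P, hP, hu⟩
    exact ⟨c • P, (Polynomial.natDegree_smul_le c P).trans hP, fun t => by simp [hu]⟩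

theorem polyCurve_mul_le (γ : ℂ → GL3) (m n : ℕ) :
    polyCurve γ m * polyCurve γ n ≤ polyCurve γ (m + n) := by
  rw [Submodule.mul_le]
  rintro u ⟨P, hP, hu⟩ v ⟨Q, hQ, hv⟩
  exact ⟨P * Q, Polynomial.natDegree_mul_le_of_le hP hQ, fun t => by simp [hu, hv]⟩

theorem pow_le_polyCurve {γ : ℂ → GL3} {n : ℕ} {V : Submodule ℂ (GL3 → ℂ)}
    (hV : V ≤ polyCurve γ n) (k : ℕ) : V ^ k ≤ polyCurve γ (k * n) := by
  induction k with
  | zero =>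
    rw [pow_zero, Submodule.one_le]
    exact ⟨1, by simp, by simp⟩
  | succ k ih =>
    rw [pow_succ, Nat.succ_mul]
    exact (mul_le_mul' ih hV).trans (polyCurve_mul_le γ _ _)

theorem polyRep_le_polyCurve {γ : ℂ → GL3} {m n : ℕ} (h1 : ∀ i, minor1 i ∈ polyCurve γ m)
    (h2 : ∀ i, minorDual i ∈ polyCurve γ n) (p q : ℕ) :
    polyRep p q ≤ polyCurve γ (p * m + q * n) := by
  refine (mul_le_mul' (pow_le_polyCurve ?_ p) (pow_le_polyCurve ?_ q)).trans
    (polyCurve_mul_le γ _ _)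
  · exact Submodule.span_le.mpr (by rintro _ ⟨i, rfl⟩; exact h1 i)
  · exact Submodule.span_le.mpr (by rintro _ ⟨i, rfl⟩; exact h2 i)

end curves

/-! ### Values where only the leading entry and minor can be nonzero. -/

section torus

/-- The functions whose value at `g` is `c` times their value at the unit matrix. -/
def scaledAt (g : GL3) (c : ℂ) : Submodule ℂ (GL3 → ℂ) where
  carrier := {u | u g = c * u 1}
  zero_mem' := by simp
  add_mem' := by
    intro u v hu hv
    simp only [Set.mem_ofPred_eq, Pi.add_apply] at *
    rw [hu, hv, mul_add]
  smul_mem' := by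
    intro a u hu
    simp only [Set.mem_ofPred_eq, Pi.smul_apply, smul_eq_mul] at *
    rw [hu, mul_left_comm]

theorem scaledAt_mul_le (g : GL3) (c d : ℂ) :
    scaledAt g c * scaledAt g d ≤ scaledAt g (c * d) := by
  rw [Submodule.mul_le]
  intro u hu v hv
  change u g * v g = c * d * (u 1 * v 1)
  rw [show u g = c * u 1 from hu, show v g = d * v 1 from hv]
  ring

theorem pow_le_scaledAt {g : GL3} {c : ℂ} {V : Submodule ℂ (GL3 → ℂ)}
    (hV : V ≤ scaledAt g c) (k : ℕ) : V ^ k ≤ scaledAt g (c ^ k) := by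
  induction k with
  | zero =>
    rw [pow_zero, Submodule.one_le]
    simp [scaledAt]
  | succ k ih =>
    rw [pow_succ, pow_succ]
    exact (mul_le_mul' ih hV).trans (scaledAt_mul_le g _ _)

theorem polyRep_le_scaledAt {g : GL3} (h1 : minor1 1 g = 0) (h2 : minor1 2 g = 0)
    (h3 : minorDual 0 g = 0) (h4 : minorDual 1 g = 0) (p q : ℕ) :
    polyRep p q ≤ scaledAt g (minor1 0 g ^ p * minorDual 2 g ^ q) := by
  refine (mul_le_mul' (pow_le_scaledAt ?_ p) (pow_le_scaledAt ?_ q)).trans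
    (scaledAt_mul_le g _ _)
  · refine Submodule.span_le.mpr ?_
    rintro _ ⟨i, rfl⟩
    change minor1 i g = _ * minor1 i 1
    rw [minor1_one]
    fin_cases i <;> simp [h1, h2]
  · refine Submodule.span_le.mpr ?_
    rintro _ ⟨i, rfl⟩
    change minorDual i g = _ * minorDual i 1
    rw [minorDual_one]
    fin_cases i <;> simp [h3, h4]

end torus

theorem mem_polyCurve_C {γ : ℂ → GL3} {n : ℕ} {u : GL3 → ℂ} (c : ℂ) (h : ∀ t, u (γ t) = c) :
    u ∈ polyCurve γ n := ⟨Polynomial.C c, by simp, fun t => by simp [h]⟩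

theorem mem_polyCurve_linear {γ : ℂ → GL3} {u : GL3 → ℂ} (c : ℂ) (h : ∀ t, u (γ t) = c * t) :
    u ∈ polyCurve γ 1 :=
  ⟨Polynomial.C c * Polynomial.X, by simpa using Polynomial.natDegree_C_mul_X_pow_le c 1, fun t => by simp [h]⟩

theorem polyRep_le_polyCurve_first (p q : ℕ) :
    polyRep p q ≤ polyCurve (fun t => upperUni (-t) 0 0) p := by
  have h := polyRep_le_polyCurve (γ := fun t => upperUni (-t) 0 0) (m := 1) (n := 0) ?_ ?_ p q
  · simpa using h
  · intro i
    obtain rfl | rfl | rfl : i = 0 ∨ i = 1 ∨ i = 2 := by fin_cases i <;> simp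
    · exact mem_polyCurve_C 1 fun t => by simp [minor1, coe_upperUni]
    · exact mem_polyCurve_linear (-1) fun t => by simp [minor1, coe_upperUni]
    · exact mem_polyCurve_C 0 fun t => by simp [minor1, coe_upperUni]
  · intro i
    obtain rfl | rfl | rfl : i = 0 ∨ i = 1 ∨ i = 2 := by fin_cases i <;> simp
    · exact mem_polyCurve_C 0 fun t => by simp [minorDual_zero_apply, coe_upperUni]
    · exact mem_polyCurve_C 0 fun t => by simp [minorDual_one_apply, coe_upperUni]
    · exact mem_polyCurve_C 1 fun t => by simp [minorDual_two_apply, coe_upperUni]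

theorem polyRep_le_polyCurve_second (p q : ℕ) :
    polyRep p q ≤ polyCurve (fun t => upperUni 0 0 (-t)) q := by
  have h := polyRep_le_polyCurve (γ := fun t => upperUni 0 0 (-t)) (m := 0) (n := 1) ?_ ?_ p q
  · simpa using h
  · intro i
    obtain rfl | rfl | rfl : i = 0 ∨ i = 1 ∨ i = 2 := by fin_cases i <;> simp
    · exact mem_polyCurve_C 1 fun t => by simp [minor1, coe_upperUni]
    · exact mem_polyCurve_C 0 fun t => by simp [minor1, coe_upperUni]
    · exact mem_polyCurve_C 0 fun t => by simp [minor1, coe_upperUni]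
  · intro i
    obtain rfl | rfl | rfl : i = 0 ∨ i = 1 ∨ i = 2 := by fin_cases i <;> simp
    · exact mem_polyCurve_C 0 fun t => by simp [minorDual_zero_apply, coe_upperUni]
    · exact mem_polyCurve_linear 1 fun t => by simp [minorDual_one_apply, coe_upperUni]
    · exact mem_polyCurve_C 1 fun t => by simp [minorDual_two_apply, coe_upperUni]

/-! ### Density of the locus with nonzero leading minors. -/

section density

/-- A curve of lower unitriangular matrices. -/
noncomputable def lowerCurve (t : ℂ) : GL3 :=
  Matrix.GeneralLinearGroup.mkOfDetNeZero !![1, 0, 0; t, 1, 0; t ^ 2, 2 * t, 1] (by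
    simp [Matrix.det_fin_three])

theorem coe_lowerCurve (t : ℂ) :
    (lowerCurve t : Matrix (Fin 3) (Fin 3) ℂ) = !![1, 0, 0; t, 1, 0; t ^ 2, 2 * t, 1] := rfl

theorem lowerCurve_zero : lowerCurve 0 = 1 := by
  refine Units.ext ?_
  rw [coe_lowerCurve]
  ext i j
  fin_cases i <;> fin_cases j <;> simp

open Polynomial in
theorem mem_polyCurve_quadratic {γ : ℂ → GL3} {u : GL3 → ℂ} (a b c : ℂ)
    (h : ∀ t, u (γ t) = a * t ^ 2 + b * t + c) : u ∈ polyCurve γ 2 :=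
  ⟨C a * X ^ 2 + C b * X + C c, natDegree_quadratic_le, fun t => by simp [h]⟩

theorem minor1_mul_lowerCurve (a : GL3) (t : ℂ) :
    minor1 0 (a * lowerCurve t) = minor1 2 a * t ^ 2 + minor1 1 a * t + minor1 0 a ∧
    minor1 1 (a * lowerCurve t) = 0 * t ^ 2 + 2 * minor1 2 a * t + minor1 1 a ∧
    minor1 2 (a * lowerCurve t) = minor1 2 a := by
  simp only [minor1_mul, Fin.sum_univ_three, coe_lowerCurve]
  refine ⟨?_, ?_, ?_⟩ <;> simp <;> ring

/-- The entry `2 * t` of the curve matters: with `t` in its place the coefficient of `minorDual 0`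
in the last formula would cancel. -/
theorem minorDual_mul_lowerCurve (a : GL3) (t : ℂ) :
    minorDual 0 (a * lowerCurve t) = minorDual 0 a ∧
    minorDual 1 (a * lowerCurve t) = 0 * t ^ 2 + (-minorDual 0 a) * t + minorDual 1 a ∧
    minorDual 2 (a * lowerCurve t) =
      minorDual 0 a * t ^ 2 + (-2 * minorDual 1 a) * t + minorDual 2 a := by
  simp only [minorDual_zero_apply, minorDual_one_apply, minorDual_two_apply, Units.val_mul,
    Matrix.mul_apply, Fin.sum_univ_three, coe_lowerCurve]
  refine ⟨?_, ?_, ?_⟩ <;> simp <;> ring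

theorem exists_minor1_ne_zero (a : GL3) : ∃ i, minor1 i a ≠ 0 := by
  by_contra! h
  have hdet : (a : Matrix (Fin 3) (Fin 3) ℂ).det ≠ 0 := a.det_ne_zero
  have h0 := h 0
  have h1 := h 1
  have h2 := h 2
  simp only [minor1] at h0 h1 h2
  rw [Matrix.det_fin_three, h0, h1, h2] at hdet
  simp at hdet

theorem exists_minorDual_ne_zero (a : GL3) : ∃ i, minorDual i a ≠ 0 := by
  by_contra! h
  have hdet : (a : Matrix (Fin 3) (Fin 3) ℂ).det ≠ 0 := a.det_ne_zero
  have h0 := h 0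
  have h1 := h 1
  have h2 := h 2
  simp only [minorDual_zero_apply, minorDual_one_apply, minorDual_two_apply] at h0 h1 h2
  refine hdet ?_
  rw [Matrix.det_fin_three]
  linear_combination a 2 0 * h0 + a 2 1 * h1 + a 2 2 * h2

open Polynomial in
/-- An element of `polyRep p q` that vanishes where the leading minors do not vanish is zero. -/
theorem eq_zero_of_vanish_generic {p q : ℕ} {u : GL3 → ℂ} (hu : u ∈ polyRep p q)
    (h : ∀ a, minor1 0 a ≠ 0 → minorDual 2 a ≠ 0 → u a = 0) (a : GL3) : u a = 0 := by
  have hle := polyRep_le_polyCurve (γ := fun t => a * lowerCurve t) (m := 2) (n := 2) ?_ ?_ p q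
  · obtain ⟨P, -, hP⟩ := hle hu
    -- Up to nonzero factors the coefficients of `A` and `B` are all the row entries and all the
    -- minors of `a`, so invertibility of `a` makes both polynomials nonzero.
    let A : ℂ[X] := C (minor1 2 a) * X ^ 2 + C (minor1 1 a) * X + C (minor1 0 a)
    let B : ℂ[X] := C (minorDual 0 a) * X ^ 2 + C (-2 * minorDual 1 a) * X + C (minorDual 2 a)
    have hA : ∀ t, A.eval t = minor1 0 (a * lowerCurve t) := fun t => by
      rw [(minor1_mul_lowerCurve a t).1]; simp [A]
    have hB : ∀ t, B.eval t = minorDual 2 (a * lowerCurve t) := fun t => by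
      rw [(minorDual_mul_lowerCurve a t).2.2]; simp [B]
    have hprod : P * (A * B) = 0 := by
      refine Polynomial.funext fun t => ?_
      rw [eval_mul, eval_mul, hA, hB, eval_zero, ← hP]
      by_cases h1 : minor1 0 (a * lowerCurve t) = 0
      · rw [h1]; ring
      by_cases h2 : minorDual 2 (a * lowerCurve t) = 0
      · rw [h2]; ring
      rw [h _ h1 h2, zero_mul]
    have hA0 : A ≠ 0 := fun h0 => by
      obtain ⟨i, hi⟩ := exists_minor1_ne_zero a
      have c0 := congrArg (coeff · 0) h0
      have c1 := congrArg (coeff · 1) h0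
      have c2 := congrArg (coeff · 2) h0
      simp [A, coeff_X, coeff_C] at c0 c1 c2
      fin_cases i <;> simp_all
    have hB0 : B ≠ 0 := fun h0 => by
      obtain ⟨i, hi⟩ := exists_minorDual_ne_zero a
      have c0 := congrArg (coeff · 0) h0
      have c1 := congrArg (coeff · 1) h0
      have c2 := congrArg (coeff · 2) h0
      simp [B, coeff_X, coeff_C] at c0 c1 c2
      fin_cases i <;> simp_all
    have hP0 : P = 0 := (mul_eq_zero.mp hprod).resolve_right (mul_ne_zero hA0 hB0)
    have := hP 0
    dsimp only at this
    rwa [lowerCurve_zero, mul_one, hP0, eval_zero] at this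
  · intro i
    obtain rfl | rfl | rfl : i = 0 ∨ i = 1 ∨ i = 2 := by fin_cases i <;> simp
    · exact mem_polyCurve_quadratic _ _ _ fun t => (minor1_mul_lowerCurve a t).1
    · exact mem_polyCurve_quadratic _ _ _ fun t => (minor1_mul_lowerCurve a t).2.1
    · exact mem_polyCurve_C _ fun t => (minor1_mul_lowerCurve a t).2.2
  · intro i
    obtain rfl | rfl | rfl : i = 0 ∨ i = 1 ∨ i = 2 := by fin_cases i <;> simp
    · exact mem_polyCurve_C _ fun t => (minorDual_mul_lowerCurve a t).1
    · exact mem_polyCurve_quadratic _ _ _ fun t => (minorDual_mul_lowerCurve a t).2.1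
    · exact mem_polyCurve_quadratic _ _ _ fun t => (minorDual_mul_lowerCurve a t).2.2

end density

/-! ### Highest vectors. -/

section highest

variable {p q r s : ℕ} {F : GL3 × GL3 → ℂ}

/-- A highest vector that vanishes when its first argument is the unit matrix is zero. -/
theorem eq_zero_of_highest_of_one (hF : F ∈ highestVectors (tensorFun (polyRep p q) (polyRep r s)))
    (h1 : ∀ b, F (1, b) = 0) : F = 0 := by
  have hslice := (slice_mem_polyRep hF.1).2
  ext ⟨a, b⟩
  refine eq_zero_of_vanish_generic (hslice b) (fun a ha1 ha2 => ?_) a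
  -- These parameters clear `minor1 1`, `minor1 2` and `minorDual 1`; the relation then clears
  -- `minorDual 0`.
  let v : ℂ := minorDual 1 a / minorDual 2 a
  let y : ℂ := -minor1 1 a / minor1 0 a
  let w : ℂ := -(minor1 1 a * v + minor1 2 a) / minor1 0 a
  have k0 : minor1 0 (a * upperUni y w v) = minor1 0 a := by
    simp [minor1_mul, Fin.sum_univ_three, coe_upperUni]
  have k1 : minor1 1 (a * upperUni y w v) = 0 := by
    simp [minor1_mul, Fin.sum_univ_three, coe_upperUni, y]
    field_simp
    ring
  have k2 : minor1 2 (a * upperUni y w v) = 0 := by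
    simp [minor1_mul, Fin.sum_univ_three, coe_upperUni, w]
    field_simp
    ring
  have k3 : minorDual 1 (a * upperUni y w v) = 0 := by
    have : minorDual 1 (a * upperUni y w v) = minorDual 1 a - v * minorDual 2 a := by
      simp only [minorDual_one_apply, minorDual_two_apply, Units.val_mul,
        Matrix.mul_apply, Fin.sum_univ_three, coe_upperUni]
      simp
      ring
    rw [this]
    simp only [v]
    field_simp
    ring
  have k4 : minorDual 0 (a * upperUni y w v) = 0 := by
    have := minor_relation (a * upperUni y w v)
    rw [k0, k1, k2, zero_mul, zero_mul, add_zero, add_zero] at this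
    exact (mul_eq_zero.mp this).resolve_left ha1
  rw [← apply_mul_upperUni hF.2 a b y w v]
  have := polyRep_le_scaledAt k1 k2 k4 k3 p q (hslice (b * upperUni y w v))
  exact this.trans (by dsimp only; rw [h1, mul_zero])

/-- Invariance moves `y` into the first argument, where only row entries depend on it, linearly;
hence the degree is at most `p`. -/
theorem highest_first_slice (hF : F ∈ highestVectors (tensorFun (polyRep p q) (polyRep r s)))
    (w v : ℂ) : ∃ P : Polynomial ℂ, P.degree < (p + 1 : ℕ) ∧
      ∀ y, F (1, upperUni y w v) = P.eval y := by
  obtain ⟨P, hP, h⟩ := polyRep_le_polyCurve_first p q ((slice_mem_polyRep hF.1).2 (upperUni 0 w v))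
  refine ⟨P, Polynomial.degree_lt_iff_coeff_zero _ _ |>.mpr fun m hm =>
    Polynomial.coeff_eq_zero_of_natDegree_lt (by omega), fun y => ?_⟩
  rw [← h]
  dsimp only
  rw [← apply_mul_upperUni hF.2 (upperUni (-y) 0 0) _ y 0 0, upperUni_mul, upperUni_mul]
  simp [upperUni_zero]

/-- The mirror image, with `x = y * v - w` held fixed: once moved to the first argument, `v` enters
only through the minors. -/
theorem highest_second_slice (hF : F ∈ highestVectors (tensorFun (polyRep p q) (polyRep r s)))
    (x y : ℂ) : ∃ P : Polynomial ℂ, P.degree < (q + 1 : ℕ) ∧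
      ∀ v, F (1, upperUni y (y * v - x) v) = P.eval v := by
  obtain ⟨P, hP, h⟩ := polyRep_le_polyCurve_second p q
    ((slice_mem_polyRep hF.1).2 (upperUni y (-x) 0))
  refine ⟨P, Polynomial.degree_lt_iff_coeff_zero _ _ |>.mpr fun m hm =>
    Polynomial.coeff_eq_zero_of_natDegree_lt (by omega), fun v => ?_⟩
  rw [← h]
  dsimp only
  rw [← apply_mul_upperUni hF.2 (upperUni 0 0 (-v)) _ 0 0 v, upperUni_mul, upperUni_mul]
  simp [upperUni_zero, sub_eq_neg_add]

theorem fVec_mem_highestVectors {m₁ m₂ n₁ n₂ : ℕ} {e : Exponents}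
    (he : e.Admissible m₁ m₂ n₁ n₂) :
    fVec e ∈ highestVectors (tensorFun (polyRep (m₁ - m₂) m₂) (polyRep (n₁ - n₂) n₂)) :=
  ⟨fVec_mem_tensorFun he, fun _ _ hij => fVec_isLieImage_matE_zero e hij⟩

theorem Exponents.ext_of_eq {e f : Exponents} (h1 : e.α = f.α) (h2 : e.β = f.β) (h3 : e.γ = f.γ)
    (h4 : e.δ = f.δ) (h5 : e.ω = f.ω) (h6 : e.φ = f.φ) (h7 : e.ψ = f.ψ) (h8 : e.θ = f.θ) :
    e = f := by
  cases e; cases f; simp_all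

theorem linearIndependent_fVec (m₁ m₂ n₁ n₂ : ℕ) : LinearIndependent ℂ
    fun e : {e : Exponents // e.Admissible m₁ m₂ n₁ n₂ ∧ (e.ω = 0 ∨ e.θ = 0)} => fVec e.1 := by
  rw [linearIndependent_iff']
  intro S c hc i hi
  -- With `K = 0` the zero polynomial qualifies, its degree being `⊥`, and every coefficient is
  -- forced to vanish.
  refine coeff_eq_zero_of_degree_lt S c (fun e => e.1.ω) (fun e => e.1.φ) (fun e => e.1.ψ)
    (fun e => e.1.θ) ?_ (fun e _ => e.2.2) 0 (fun w v => ⟨0, ?_, fun y => ?_⟩) i hi (Nat.zero_le _)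
  · rintro ⟨e, ⟨h1, h2, h3, h4⟩, _⟩ _ ⟨f, ⟨k1, k2, k3, k4⟩, _⟩ _ hω hφ hψ hθ
    dsimp only at hω hφ hψ hθ
    exact Subtype.ext (Exponents.ext_of_eq (by dsimp only; omega) (by dsimp only; omega)
      (by dsimp only; omega) (by dsimp only; omega) hω hφ hψ hθ)
  · simp
  · have h := congrFun hc (1, upperUni y w v)
    rw [Finset.sum_apply] at h
    simpa [fVec_one_upperUni] using h

theorem highestVectors_le_span_fVec {m₁ m₂ n₁ n₂ : ℕ}
    (hF : F ∈ highestVectors (tensorFun (polyRep (m₁ - m₂) m₂) (polyRep (n₁ - n₂) n₂))) :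
    F ∈ Submodule.span ℂ (Set.range
      fun e : {e : Exponents // e.Admissible m₁ m₂ n₁ n₂ ∧ (e.ω = 0 ∨ e.θ = 0)} => fVec e.1) := by
  obtain ⟨l, hl, hlF⟩ := (Finsupp.mem_span_image_iff_linearCombination ℂ).mp
    (polyRep_le_span_standard _ _ ((slice_mem_polyRep hF.1).1 1))
  rw [Finsupp.mem_supported] at hl
  have hF1 : ∀ b, F (1, b) = ∑ e ∈ l.support, l e * fVec e (1, b) := fun b => by
    rw [← congrFun hlF b, Finsupp.linearCombination_apply, Finsupp.sum, Finset.sum_apply]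
    rfl
  have hinj : ∀ e ∈ l.support, ∀ f ∈ l.support, e.ω = f.ω → e.φ = f.φ → e.ψ = f.ψ → e.θ = f.θ →
      e = f := by
    intro e he f hf hω hφ hψ hθ
    obtain ⟨⟨h1, h2, h3, h4⟩, -⟩ := hl he
    obtain ⟨⟨k1, k2, k3, k4⟩, -⟩ := hl hf
    exact Exponents.ext_of_eq (by omega) (by omega) (by omega) (by omega) hω hφ hψ hθ
  have hfirst : ∀ e ∈ l.support, e.ω + e.φ ≤ m₁ - m₂ := fun e he => by
    by_contra hlt
    refine Finsupp.mem_support_iff.mp he (coeff_eq_zero_of_degree_lt l.support l Exponents.ω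
      Exponents.φ Exponents.ψ Exponents.θ hinj (fun e he => (hl he).2) (m₁ - m₂ + 1)
      (fun w v => ?_) e he (by omega))
    obtain ⟨P, hP, h⟩ := highest_first_slice hF w v
    exact ⟨P, hP, fun y => by rw [← h, hF1]; simp only [fVec_one_upperUni]⟩
  have hsecond : ∀ e ∈ l.support, e.θ + e.ψ ≤ m₂ := fun e he => by
    by_contra hlt
    -- In the coordinates `x, y, v` the monomial is `v^θ (v y - x)^ψ x^φ y^ω`, so the same lemma
    -- applies with the exponents in reverse order.
    refine Finsupp.mem_support_iff.mp he (coeff_eq_zero_of_degree_lt l.support l Exponents.θ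
      Exponents.ψ Exponents.φ Exponents.ω (fun e he f hf h1 h2 h3 h4 => hinj e he f hf h4 h3 h2 h1)
      (fun e he => (hl he).2.symm) (m₂ + 1) (fun x y => ?_) e he (by omega))
    obtain ⟨P, hP, h⟩ := highest_second_slice hF x y
    refine ⟨P, hP, fun v => ?_⟩
    rw [← h, hF1]
    refine Finset.sum_congr rfl fun e _ => ?_
    rw [fVec_one_upperUni]
    ring
  -- Restores the exponents lost at `a = 1`. By `hfirst` and `hsecond` the subtractions are not
  -- truncated, and the restriction to `a = 1` is unchanged.
  let lift : Exponents → Exponents := fun e =>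
    { e with α := m₁ - m₂ - e.ω - e.φ, γ := m₂ - e.θ - e.ψ }
  have hlift : ∀ e ∈ l.support, (lift e).Admissible m₁ m₂ n₁ n₂ ∧
      ((lift e).ω = 0 ∨ (lift e).θ = 0) := fun e he => by
    obtain ⟨⟨-, -, h3, h4⟩, h5⟩ := hl he
    have h6 := hfirst e he
    have h7 := hsecond e he
    refine ⟨⟨?_, ?_, h3, h4⟩, h5⟩ <;>
    · dsimp only [lift]; omega
  have hsum : F - ∑ e ∈ l.support, l e • fVec (lift e) = 0 := by
    refine eq_zero_of_highest_of_one (Submodule.sub_mem _ hF (Submodule.sum_mem _ fun e he =>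
      Submodule.smul_mem _ _ (fVec_mem_highestVectors (hlift e he).1))) fun b => ?_
    rw [Pi.sub_apply, hF1, Finset.sum_apply, sub_eq_zero]
    refine Finset.sum_congr rfl fun e _ => ?_
    rw [Pi.smul_apply, smul_eq_mul, fVec_one_apply, fVec_one_apply]
  rw [sub_eq_zero.mp hsum]
  exact Submodule.sum_mem _ fun e he =>
    Submodule.smul_mem _ _ (Submodule.subset_span ⟨⟨lift e, hlift e he⟩, rfl⟩)

end highest

/-! ### The basis. -/

theorem Submodule.exists_basis_of_le_span {ι M : Type*} [AddCommGroup M] [Module ℂ M]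
    (T : Submodule ℂ M) (v : ι → M) (hv : ∀ i, v i ∈ T) (hli : LinearIndependent ℂ v)
    (hT : T ≤ Submodule.span ℂ (Set.range v)) :
    ∃ B : Module.Basis ι ℂ T, ∀ i, (B i : M) = v i := by
  have hspan : T = Submodule.span ℂ (Set.range v) :=
    le_antisymm hT (Submodule.span_le.mpr (by rintro _ ⟨i, rfl⟩; exact hv i))
  subst hspan
  exact ⟨Module.Basis.span hli, fun i => congrArg Subtype.val (Module.Basis.span_apply hli i)⟩

theorem fVec_ne_zero {m₁ m₂ n₁ n₂ : ℕ} {e : Exponents} (he : e.Admissible m₁ m₂ n₁ n₂)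
    (h0 : e.ω = 0 ∨ e.θ = 0) : fVec e ≠ 0 := by
  let i : {e : Exponents // e.Admissible m₁ m₂ n₁ n₂ ∧ (e.ω = 0 ∨ e.θ = 0)} := ⟨e, he, h0⟩
  have h := LinearIndependent.ne_zero i (linearIndependent_fVec m₁ m₂ n₁ n₂)
  exact h

theorem mainTheorem2 (m₁ m₂ n₁ n₂ : ℕ) (hm : m₂ ≤ m₁) (hn : n₂ ≤ n₁) :
    (∃ B : Module.Basis {e : Exponents // e.Admissible m₁ m₂ n₁ n₂ ∧ (e.ω = 0 ∨ e.θ = 0)} ℂ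
        (highestVectors (tensorFun (irrep m₁ m₂) (irrep n₁ n₂))),
      ∀ e, (B e : GL3 × GL3 → ℂ) = fVec e.1) ∧
    ∀ e : Exponents, e.Admissible m₁ m₂ n₁ n₂ → (e.ω = 0 ∨ e.θ = 0) →
      IsWeightVector (fVec e) := by
  have hli := linearIndependent_fVec m₁ m₂ n₁ n₂
  refine ⟨?_, fun e he h0 => ⟨fVec_ne_zero he h0, fVec_isLieImage_matE_self e⟩⟩
  refine Submodule.exists_basis_of_le_span _ _ (fun e => ?_) hli fun F hF => ?_
  · rw [irrep_eq_polyRep, irrep_eq_polyRep]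
    exact fVec_mem_highestVectors e.2.1
  · rw [irrep_eq_polyRep, irrep_eq_polyRep] at hF
    exact highestVectors_le_span_fVec hF
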